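/- Throughout, $\log=\log_2$. Let $\mathbb F$ be a field, $n,d\ge 1$ integers, $\mathbf A\in\mathbb F^{n\times n}$, $0<\epsilon\le 1/e$, let $\eta\in(0,\frac12)$ satisfy $\eta\log(1/\eta)=\epsilon$, and put $m=\lceil\log(1/\eta)\rceil$. The matrix $\mathbf A$ is called $\epsilon$-far from having rank at most $d$ if every matrix of rank at most $d$ in $\mathbb F^{n\times n}$ differs from $\mathbf A$ in at least $\epsilon n^2$ entries. The non-adaptive rank tester with parameter $c>0$ works as follows. 1. It chooses row sets $\mathcal R_1\subseteq\cdots\subseteq\mathcal R_m\subseteq[n]$ and, independently, column sets $[n]\supseteq\mathcal C_1\supseteq\cdots\supseteq\mathcal C_m$, uniformly at random among all such nested sets of sizes $$|\mathcal R_i|=\min\{n,\lceil c\,[\log d+\log\log(1/\eta)]\,d\log(1/\eta)\,2^i\rceil\},\qquad |\mathcal C_i|=\min\{n,\lceil c\,[\log d+\log\log(1/\eta)]\,d\log(1/\eta)/(2^i\eta)\rceil\}.$$ 2. It queries the entries of $\mathbf A$ at the positions $\mathcal Q=\bigcup_{i=1}^m\mathcal R_i\times\mathcal C_i$, and computes the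 minimum $r$ of the ranks of all $\mathcal R_m\times\mathcal C_1$ matrices over $\mathbb F$ that agree with $\mathbf A$ on $\mathcal Q$. 3. It outputs "$\mathbf A$ is $\epsilon$-far from having rank $d$" if $r>d$, and "$\mathbf A$ is of rank at most $d$" otherwise. **Theorem.** There is an absolute exponent $K$, and for every $k\in\mathbb N$ there is a constant $c_0>0$ depending only on $k$, such that for every $c\ge c_0$ there is a constant $C>0$ depending only on $k$ and $c$ such that the following holds for all $n,d,\epsilon,\eta,\mathbb F,\mathbf A$ as above. * The tester always queries at most $C\,\frac{d^2}{\epsilon}\,\log^K(d/\epsilon)$ entries, that is, $\widetilde{\mathcal O}(d^2/\epsilon)$ entries, independently of $n$. * If $\mathbf A$ has rank at most $d$, then the tester outputs "$\mathbf A$ is of rank at most $d$" with probability $1$. * If $\mathbf A$ is $\epsilon$-far from having rank at most $d$, then the tester outputs "$\mathbf A$ is of rank at most $d$" with probability at most $(d\log(1/\epsilon))^{-k}$. -/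

import Mathlib

open scoped BigOperators

namespace RankTesting

/-- The matrix `A` is `ε`-far from having rank at most `d`: at least an `ε`-fraction of its `n²`
entries has to be changed in order to obtain a matrix of rank at most `d`. -/
def IsFarFromRank {F : Type*} [Field F] {n : ℕ} (A : Matrix (Fin n) (Fin n) F) (d : ℕ) (ε : ℝ) :
    Prop :=
  ∀ B : Matrix (Fin n) (Fin n) F, B.rank ≤ d →
    ε * (n : ℝ) ^ 2 ≤ ({p : Fin n × Fin n | A p.1 p.2 ≠ B p.1 p.2}.ncard : ℝ)

/-- The number `m = ⌈log (1/η)⌉` of sampled blocks; logarithms are to base `2`. -/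
noncomputable def numBlocks (η : ℝ) : ℕ := ⌈Real.logb 2 (1 / η)⌉₊

/-- The factor `c [log d + log log (1/η)] d log (1/η)` common to the sizes of all blocks. -/
noncomputable def sizeFactor (d : ℕ) (c η : ℝ) : ℝ :=
  c * (Real.logb 2 d + Real.logb 2 (Real.logb 2 (1 / η))) * d * Real.logb 2 (1 / η)

/-- The number `c [log d + log log (1/η)] d log (1/η) 2 ^ i` of rows of the `i`-th block, rounded
up to an integer, or all `n` rows if there are not that many. -/
noncomputable def rowSize (n d : ℕ) (c η : ℝ) (i : ℕ) : ℕ :=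
  min n ⌈sizeFactor d c η * 2 ^ i⌉₊

/-- The number `c [log d + log log (1/η)] d log (1/η) / (2 ^ i η)` of columns of the `i`-th block,
rounded up to an integer, or all `n` columns if there are not that many. -/
noncomputable def colSize (n d : ℕ) (c η : ℝ) (i : ℕ) : ℕ :=
  min n ⌈sizeFactor d c η / (2 ^ i * η)⌉₊

/-- Row index sets `R₁, …, Rₘ` and column index sets `C₁, …, Cₘ`. The element `j : Fin m` stands
for the index `i = j + 1`. -/
abbrev Blocks (n m : ℕ) : Type := (Fin m → Finset (Fin n)) × (Fin m → Finset (Fin n))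

open Classical in
/-- All choices of index sets `R₁ ⊆ ⋯ ⊆ Rₘ` and `C₁ ⊇ ⋯ ⊇ Cₘ` of the prescribed sizes. -/
noncomputable def nestedBlocks (n d : ℕ) (c η : ℝ) : Finset (Blocks n (numBlocks η)) :=
  {ω | Monotone ω.1 ∧ Antitone ω.2 ∧
    (∀ j, (ω.1 j).card = rowSize n d c η (j + 1)) ∧
    (∀ j, (ω.2 j).card = colSize n d c η (j + 1))}

theorem ceil_mul_two_pow_mono (x : ℝ) : Monotone fun i : ℕ => ⌈x * 2 ^ i⌉₊ := by
  intro i j hij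
  rcases le_total 0 x with hx | hx
  · exact Nat.ceil_mono
      (mul_le_mul_of_nonneg_left (pow_le_pow_right₀ (by norm_num) hij) hx)
  · have h : x * 2 ^ i ≤ 0 := mul_nonpos_of_nonpos_of_nonneg hx (by positivity)
    simp only [Nat.ceil_eq_zero.2 h, zero_le]

theorem ceil_div_two_pow_anti (x : ℝ) : Antitone fun i : ℕ => ⌈x / 2 ^ i⌉₊ := by
  intro i j hij
  rcases le_total 0 x with hx | hx
  · exact Nat.ceil_mono
      (div_le_div_of_nonneg_left hx (by positivity) (pow_le_pow_right₀ (by norm_num) hij))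
  · have h : x / 2 ^ j ≤ 0 := div_nonpos_of_nonpos_of_nonneg hx (by positivity)
    simp only [Nat.ceil_eq_zero.2 h, zero_le]

theorem rowSize_mono (n d : ℕ) (c η : ℝ) : Monotone (rowSize n d c η) := fun _ _ hij =>
  min_le_min le_rfl (ceil_mul_two_pow_mono _ hij)

theorem colSize_anti (n d : ℕ) (c η : ℝ) : Antitone (colSize n d c η) := by
  intro i j hij
  have h := ceil_div_two_pow_anti (sizeFactor d c η / η) hij
  simp only [div_div, mul_comm η] at h
  exact min_le_min le_rfl h

theorem nestedBlocks_nonempty (n d : ℕ) (c η : ℝ) : (nestedBlocks n d c η).Nonempty := by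
  classical
  have key : ∀ k, k ≤ n → ((Finset.univ : Finset (Fin n)).filter fun x => x.val < k).card = k := by
    intro k hk
    rw [Fin.card_filter_val_lt, min_eq_right hk]
  refine ⟨(fun j => Finset.univ.filter fun x => x.val < rowSize n d c η (j + 1),
    fun j => Finset.univ.filter fun x => x.val < colSize n d c η (j + 1)), ?_⟩
  simp only [nestedBlocks, Finset.mem_filter, Finset.mem_univ, true_and]
  refine ⟨?_, ?_, fun j => key _ (min_le_left _ _), fun j => key _ (min_le_left _ _)⟩
  · intro i j hij x hx
    simp only [Finset.mem_filter, Finset.mem_univ, true_and] at hx ⊢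
    exact hx.trans_le (rowSize_mono n d c η (Nat.add_le_add_right hij 1))
  · intro i j hij x hx
    simp only [Finset.mem_filter, Finset.mem_univ, true_and] at hx ⊢
    exact hx.trans_le (colSize_anti n d c η (Nat.add_le_add_right hij 1))

/-- The random choice of the blocks: uniform among all nested index sets of the prescribed sizes. -/
noncomputable def blockLaw (n d : ℕ) (c η : ℝ) : PMF (Blocks n (numBlocks η)) :=
  PMF.uniformOfFinset (nestedBlocks n d c η) (nestedBlocks_nonempty n d c η)

/-- The set `Q = ⋃ᵢ Rᵢ × Cᵢ` of queried positions. -/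
def querySet {n m : ℕ} (ω : Blocks n m) : Finset (Fin n × Fin n) :=
  Finset.univ.biUnion fun j => ω.1 j ×ˢ ω.2 j

/-- All sampled rows; for nested blocks this is the largest row set `Rₘ`. -/
def sampledRows {n m : ℕ} (ω : Blocks n m) : Finset (Fin n) := Finset.univ.biUnion ω.1

/-- All sampled columns; for nested blocks this is the largest column set `C₁`. -/
def sampledCols {n m : ℕ} (ω : Blocks n m) : Finset (Fin n) := Finset.univ.biUnion ω.2

/-- The least rank of an `Rₘ × C₁` matrix whose entries at the queried positions are the observed
values `obs`, the entries at the other positions being arbitrary. -/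
noncomputable def minCompletionRank {F : Type*} [Field F] {n m : ℕ} (ω : Blocks n m)
    (obs : querySet ω → F) : ℕ :=
  sInf {r : ℕ | ∃ M : Matrix (sampledRows ω) (sampledCols ω) F,
    (∀ (i : sampledRows ω) (j : sampledCols ω) (h : (i.1, j.1) ∈ querySet ω),
      M i j = obs ⟨(i.1, j.1), h⟩) ∧ M.rank = r}

/-- The possible outputs: "`A` has rank at most `d`" and "`A` is `ε`-far from having rank `d`". -/
inductive Verdict : Type
  | rankAtMost : Verdict
  | far : Verdict

/-- The decision of the tester, which sees nothing but the blocks and the queried entries. -/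
noncomputable def decision {F : Type*} [Field F] {n m : ℕ} (d : ℕ) (ω : Blocks n m)
    (obs : querySet ω → F) : Verdict :=
  if d < minCompletionRank ω obs then Verdict.far else Verdict.rankAtMost

/-- The non-adaptive rank tester: choose the blocks at random, query the entries of `A` in the
blocks, and decide; its value is the distribution of the output. -/
noncomputable def rankTester {F : Type*} [Field F] {n : ℕ} (d : ℕ) (c η : ℝ)
    (A : Matrix (Fin n) (Fin n) F) : PMF Verdict :=
  (blockLaw n d c η).map fun ω => decision d ω fun p => A p.1.1 p.1.2

end RankTesting

/-! Suppose a matrix M of rank at most d agrees with A on the nested blocks R_i × C_i. Call an entry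
(x, y) bad at level i if adjoining row x and column y to R_i × C_i raises the rank of that block.
Let row x depend on the rows R_t over C_t, let column y depend on the columns C_s over R_s, and let
t ≤ s. If (x, y) is not bad at level t, then applying both dependencies to M reproduces A x y. Doing
this for all rows and columns at once gives a product l M k, still of rank at most d
(`exists_extension`). With t and s chosen well for each row and column, fewer than ε n² entries
escape this argument, unless at some level many rows or many columns contain many bad entries
(`card_exceptional_le`). So if A is far from rank d and a completion exists, there is such a level
(`exists_heavy`).

At that level, q 2^(i+1) random rows and q 2^(m-1-i) random columns all avoid the bad entries with
probability at most 2 exp(-q/16). The level is unknown, so a round samples every level. Hitting a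
bad entry raises the sum of the m block ranks, and this sum is at most d m as long as a completion
exists. Hence, if a completion survives d m + 1 rounds, some round made no progress, and a union
bound applies (`sum_completable_le`).

The rounds draw with replacement, whereas the tester draws uniform nested sets of fixed sizes. The
law of the rounds is invariant under permutations, their blocks fit into the prescribed sizes, and
enlarging blocks only makes completion harder. Averaging over permutations transfers the bound
(`card_mul_sum_nested_le`). One-sidedness is clear, since A completes its own sample. -/

namespace RankTesting

/-! ### Bad entries and the extension of a completion. -/

section LinearAlgebra

variable {F ι κ : Type*} [Field F] [DecidableEq ι] [DecidableEq κ]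

/-- The matrix `A` with all entries outside `R × C` replaced by zero. -/
def mask (A : Matrix ι κ F) (R : Finset ι) (C : Finset κ) : Matrix ι κ F :=
  Matrix.of fun x y => if x ∈ R ∧ y ∈ C then A x y else 0

theorem mask_apply (A : Matrix ι κ F) (R : Finset ι) (C : Finset κ) (x : ι) (y : κ) :
    mask A R C x y = if x ∈ R ∧ y ∈ C then A x y else 0 := rfl

theorem mask_transpose (A : Matrix ι κ F) (R : Finset ι) (C : Finset κ) :
    mask A.transpose C R = (mask A R C).transpose := by
  ext x y
  simp [mask_apply, and_comm]

variable [Fintype ι] [Fintype κ]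

theorem mask_eq_mul (A : Matrix ι κ F) (R : Finset ι) (C : Finset κ) :
    mask A R C = Matrix.diagonal (fun x => if x ∈ R then (1 : F) else 0) * A *
      Matrix.diagonal (fun y => if y ∈ C then (1 : F) else 0) := by
  ext x y
  simp only [mask_apply, Matrix.mul_diagonal, Matrix.diagonal_mul]
  by_cases hx : x ∈ R <;> by_cases hy : y ∈ C <;> simp [hx, hy]

theorem rank_mask_le (A : Matrix ι κ F) (R : Finset ι) (C : Finset κ) :
    (mask A R C).rank ≤ A.rank := by
  rw [mask_eq_mul]
  exact (Matrix.rank_mul_le_left _ _).trans (Matrix.rank_mul_le_right _ _)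

theorem rank_mask_le_of_agree {A M : Matrix ι κ F} {R : Finset ι} {C : Finset κ}
    (h : ∀ x ∈ R, ∀ y ∈ C, M x y = A x y) : (mask A R C).rank ≤ M.rank := by
  have : mask A R C = mask M R C := by
    ext x y
    simp only [mask_apply]
    split_ifs with hxy
    · exact (h x hxy.1 y hxy.2).symm
    · rfl
  rw [this]
  exact rank_mask_le M R C

theorem rank_mask_mono (A : Matrix ι κ F) {R R' : Finset ι} {C C' : Finset κ} (hR : R ⊆ R')
    (hC : C ⊆ C') : (mask A R C).rank ≤ (mask A R' C').rank :=
  rank_mask_le_of_agree fun x hx y hy => by simp [mask_apply, hR hx, hC hy]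

/-- Adding the row `x` and the column `y` to the block `R × C` raises the rank of the block. -/
def Bad (A : Matrix ι κ F) (R : Finset ι) (C : Finset κ) (x : ι) (y : κ) : Prop :=
  (mask A R C).rank < (mask A (insert x R) (insert y C)).rank

/-- On the columns `C`, the row `x` of `A` is a linear combination of the rows `R`. -/
def RowSpanned (A : Matrix ι κ F) (R : Finset ι) (C : Finset κ) (x : ι) : Prop :=
  ∃ l : ι → F, (∀ u ∉ R, l u = 0) ∧ ∀ v ∈ C, ∑ u, l u * A u v = A x v

omit [DecidableEq ι] [DecidableEq κ] [Fintype κ] in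
theorem RowSpanned.mono {A : Matrix ι κ F} {R : Finset ι} {C C' : Finset κ} {x : ι}
    (h : RowSpanned A R C' x) (hC : C ⊆ C') : RowSpanned A R C x := by
  obtain ⟨l, hl, h⟩ := h
  exact ⟨l, hl, fun v hv => h v (hC hv)⟩

theorem bad_transpose {A : Matrix ι κ F} {R : Finset ι} {C : Finset κ} {x : ι} {y : κ} :
    Bad A.transpose C R y x ↔ Bad A R C x y := by
  simp only [Bad, mask_transpose, Matrix.rank_transpose]

/-- Adjoining only the column gives a rank between that of R × C and that of the fully enlarged
block. If these agree, adjoining row x afterwards does not enlarge the row space. -/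
theorem rowSpanned_insert_of_not_bad {A : Matrix ι κ F} {R : Finset ι} {C : Finset κ} {x : ι}
    {y : κ} (h : ¬ Bad A R C x y) : RowSpanned A R (insert y C) x := by
  set P := mask A R (insert y C) with hP
  set Q := mask A (insert x R) (insert y C) with hQ
  have hle : Submodule.span F (Set.range P.row) ≤ Submodule.span F (Set.range Q.row) := by
    rw [Submodule.span_le]
    rintro _ ⟨u, rfl⟩
    by_cases hu : u ∈ R
    · refine Submodule.subset_span ⟨u, ?_⟩
      ext v
      simp [Matrix.row, hP, hQ, mask_apply, hu]
    · have : P.row u = 0 := by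
        ext v
        simp [Matrix.row, hP, mask_apply, hu]
      rw [this]
      exact Submodule.zero_mem _
  have heq := Submodule.eq_of_le_of_finrank_le hle (by
    rw [← Matrix.rank_eq_finrank_span_row, ← Matrix.rank_eq_finrank_span_row]
    exact (not_lt.1 h).trans (rank_mask_mono A (Finset.Subset.refl R) (Finset.subset_insert y C)))
  have hx : Q.row x ∈ Submodule.span F (Set.range P.row) := by
    rw [heq]
    exact Submodule.subset_span ⟨x, rfl⟩
  obtain ⟨l, hl⟩ := Submodule.mem_span_range_iff_exists_fun F |>.1 hx
  refine ⟨fun u => if u ∈ R then l u else 0, fun u hu => if_neg hu, fun v hv => ?_⟩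
  have := congrFun hl v
  simp only [Finset.sum_apply, Pi.smul_apply, smul_eq_mul, Matrix.row, hP, hQ, mask_apply,
    hv, Finset.mem_insert_self, and_true, if_true] at this
  rw [← this]
  refine Finset.sum_congr rfl fun u _ => ?_
  by_cases hu : u ∈ R <;> simp [hu]

/-- Not being bad also makes column y a combination of the columns C on R ∪ {x}. Exchanging the two
sums shows that every combination of rows that is correct on C is correct at y, whichever l was
chosen. -/
theorem combination_eq_of_not_bad {A : Matrix ι κ F} {R : Finset ι} {C : Finset κ} {x : ι}
    {y : κ} (h : ¬ Bad A R C x y) {l : ι → F} (hl : ∀ u ∉ R, l u = 0)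
    (hlC : ∀ v ∈ C, ∑ u, l u * A u v = A x v) : ∑ u, l u * A u y = A x y := by
  obtain ⟨k, hk, hkR⟩ := rowSpanned_insert_of_not_bad (mt bad_transpose.1 h)
  simp only [Matrix.transpose_apply] at hkR
  calc ∑ u, l u * A u y = ∑ u, l u * ∑ v, k v * A u v := by
        refine Finset.sum_congr rfl fun u _ => ?_
        by_cases hu : u ∈ R
        · rw [hkR u (Finset.mem_insert_of_mem hu)]
        · simp [hl u hu]
    _ = ∑ v, k v * ∑ u, l u * A u v := by
        simp only [Finset.mul_sum]
        rw [Finset.sum_comm]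
        exact Finset.sum_congr rfl fun v _ => Finset.sum_congr rfl fun u _ => by ring
    _ = ∑ v, k v * A x v := by
        refine Finset.sum_congr rfl fun v _ => ?_
        by_cases hv : v ∈ C
        · rw [hlC v hv]
        · simp [hk v hv]
    _ = A x y := hkR x (Finset.mem_insert_self x R)

/-- A completion of a staircase pattern extends to a matrix of no larger rank that agrees with `A`
wherever the blocks assigned to the row and to the column are ordered and the entry is not bad. -/
theorem exists_extension {A M : Matrix ι κ F} {m : ℕ} {R : ℕ → Finset ι} {C : ℕ → Finset κ}
    (hR : Monotone R) (hC : Antitone C)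
    (hM : ∀ i < m, ∀ x ∈ R i, ∀ y ∈ C i, M x y = A x y) (t : ι → ℕ) (s : κ → ℕ) :
    ∃ B : Matrix ι κ F, B.rank ≤ M.rank ∧ ∀ x y, t x < m → t x ≤ s y →
      RowSpanned A (R (t x)) (C (t x)) x → RowSpanned A.transpose (C (s y)) (R (s y)) y →
      ¬ Bad A (R (t x)) (C (t x)) x y → B x y = A x y := by
  classical
  let l : Matrix ι ι F := fun x =>
    if h : RowSpanned A (R (t x)) (C (t x)) x then h.choose else 0
  let k : Matrix κ κ F := fun v y =>
    if h : RowSpanned A.transpose (C (s y)) (R (s y)) y then h.choose v else 0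
  refine ⟨l * M * k, (Matrix.rank_mul_le_left _ _).trans (Matrix.rank_mul_le_right _ _), ?_⟩
  intro x y htm hts hx hy hxy
  have hlx : l x = hx.choose := dif_pos hx
  have hky : ∀ v, k v y = hy.choose v := fun v => dif_pos hy
  obtain ⟨hl0, hl⟩ := hx.choose_spec
  obtain ⟨hk0, hk⟩ := hy.choose_spec
  rw [← hlx] at hl0 hl
  rw [← funext hky] at hk0 hk
  simp only [Matrix.transpose_apply] at hk
  rw [← combination_eq_of_not_bad hxy hl0 hl, Matrix.mul_assoc, Matrix.mul_apply]
  refine Finset.sum_congr rfl fun u _ => ?_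
  -- The order t x ≤ s y is used twice: u lies in R (s y), where k is valid, and C (s y) lies in C
  -- (t x), where M agrees with A.
  by_cases hu : u ∈ R (t x)
  · rw [← hk u (hR hts hu), Matrix.mul_apply]
    congr 1
    refine Finset.sum_congr rfl fun v _ => ?_
    by_cases hv : v ∈ C (s y)
    · rw [hM (t x) htm u hu v (hC hts hv), mul_comm]
    · simp [hk0 v hv]
  · simp [hl0 u hu]

end LinearAlgebra

/-! ### Counting the entries that the extension does not recover. -/

section Counting

open Classical in
theorem card_filter_pairs_le {n : ℕ} (X : Finset (Fin n)) (P : Fin n → Fin n → Prop) {b : ℝ}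
    (h : ∀ x ∈ X, ((Finset.univ.filter fun y => P x y).card : ℝ) ≤ b) :
    ((Finset.univ.filter fun p : Fin n × Fin n => p.1 ∈ X ∧ P p.1 p.2).card : ℝ) ≤ X.card * b := by
  have : (Finset.univ.filter fun p : Fin n × Fin n => p.1 ∈ X ∧ P p.1 p.2) =
      X.biUnion fun x => (Finset.univ.filter fun y => P x y).map
        ⟨fun y => (x, y), fun _ _ h => (Prod.ext_iff.1 h).2⟩ := by
    ext ⟨x, y⟩
    simp only [Finset.mem_filter, Finset.mem_univ, true_and, Finset.mem_biUnion, Finset.mem_map]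
    constructor
    · rintro ⟨hx, hxy⟩
      exact ⟨x, hx, y, hxy, rfl⟩
    · rintro ⟨x', hx, y', hxy, h⟩
      obtain ⟨rfl, rfl⟩ := Prod.mk.inj h
      exact ⟨hx, hxy⟩
  rw [this]
  calc (((X.biUnion _).card : ℕ) : ℝ) ≤
        ((∑ x ∈ X, (Finset.univ.filter fun y => P x y).card : ℕ) : ℝ) := by
        norm_cast
        refine Finset.card_biUnion_le.trans (le_of_eq ?_)
        simp
    _ ≤ ∑ x ∈ X, b := by
        push_cast
        exact Finset.sum_le_sum h
    _ = X.card * b := by simp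

variable {n : ℕ}

open Classical in
/-- The rows with at least `n 2 ^ (i + 1 - m) / 16` bad entries at level `i`. -/
noncomputable def heavyRows (m : ℕ) (bad : ℕ → Fin n → Fin n → Prop) (i : ℕ) : Finset (Fin n) :=
  {x | (n : ℝ) * 2 ^ (i + 1) / (16 * 2 ^ m) ≤ (Finset.univ.filter fun y => bad i x y).card}

open Classical in
/-- The columns with at least `n / (16 * 2 ^ (i + 1))` bad entries at level `i`. -/
noncomputable def heavyCols (bad : ℕ → Fin n → Fin n → Prop) (i : ℕ) : Finset (Fin n) :=
  {y | (n : ℝ) / (16 * 2 ^ (i + 1)) ≤ (Finset.univ.filter fun x => bad i x y).card}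

open Classical in
/-- If no level has many heavy rows or many heavy columns, then all but few entries are good for
the least level at which their row is not heavy, and that level does not exceed the greatest level
at which their column is not heavy. -/
theorem card_exceptional_le {m : ℕ} (hm : 1 ≤ m) (bad : ℕ → Fin n → Fin n → Prop)
    (hr : ∀ i < m, ((heavyRows m bad i).card : ℝ) ≤ n / (16 * 2 ^ (i + 1)))
    (hc : ∀ i < m, ((heavyCols bad i).card : ℝ) ≤ n * 2 ^ (i + 1) / (16 * 2 ^ m)) :
    ∃ t s : Fin n → ℕ, ((Finset.univ.filter fun p : Fin n × Fin n => ¬ (t p.1 < m ∧ s p.2 < m ∧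
        t p.1 ≤ s p.2 ∧ p.1 ∉ heavyRows m bad (t p.1) ∧ p.2 ∉ heavyCols bad (s p.2) ∧
        ¬ bad (t p.1) p.1 p.2)).card : ℝ) ≤
      (5 / 16 + (m - 1) / 64) * (n ^ 2 / 2 ^ m) := by
  have ht : ∀ x, ∃ t, x ∈ heavyRows m bad (m - 1) ∨
      (t < m ∧ x ∉ heavyRows m bad t ∧ ∀ i < t, x ∈ heavyRows m bad i) := by
    intro x
    by_cases h : ∃ t, t < m ∧ x ∉ heavyRows m bad t
    · refine ⟨Nat.find h, Or.inr ⟨(Nat.find_spec h).1, (Nat.find_spec h).2, fun i hi => ?_⟩⟩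
      by_contra hx
      exact Nat.find_min h hi ⟨hi.trans (Nat.find_spec h).1, hx⟩
    · refine ⟨0, Or.inl ?_⟩
      by_contra hx
      exact h ⟨m - 1, by omega, hx⟩
  have hs : ∀ y, ∃ s, y ∈ heavyCols bad 0 ∨
      (s < m ∧ y ∉ heavyCols bad s ∧ ∀ i, s < i → i < m → y ∈ heavyCols bad i) := by
    intro y
    -- Searching over m - 1 - s turns the greatest light level into a least witness.
    by_cases h : ∃ s, y ∉ heavyCols bad (m - 1 - s)
    · refine ⟨m - 1 - Nat.find h, Or.inr ⟨by omega, Nat.find_spec h, fun i hi him => ?_⟩⟩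
      by_contra hy
      refine Nat.find_min h (m := m - 1 - i) (by omega) ?_
      rwa [show m - 1 - (m - 1 - i) = i by omega]
    · refine ⟨0, Or.inl ?_⟩
      by_contra hy
      exact h ⟨m - 1, by simpa using hy⟩
  choose t ht using ht
  choose s hs using hs
  refine ⟨t, s, ?_⟩
  set N : ℝ := (n : ℝ) ^ 2 / 2 ^ m with hN
  have h2m : (0 : ℝ) < 2 ^ m := by positivity
  -- E1 and E2 cover the rows and columns heavy at every level. E3 and E5 cover the entries bad at
  -- the first light level t of their row, for t = 0 and t = i + 1. E4 covers the case s y < t x: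
  -- the row is heavy at t x - 1 and the column at t x.
  let E1 : Finset (Fin n × Fin n) := heavyRows m bad (m - 1) ×ˢ Finset.univ
  let E2 : Finset (Fin n × Fin n) := Finset.univ ×ˢ heavyCols bad 0
  let E3 : Finset (Fin n × Fin n) :=
    Finset.univ.filter fun p => p.1 ∈ (Finset.univ \ heavyRows m bad 0) ∧ bad 0 p.1 p.2
  let E4 : ℕ → Finset (Fin n × Fin n) := fun i => heavyRows m bad i ×ˢ heavyCols bad (i + 1)
  let E5 : ℕ → Finset (Fin n × Fin n) := fun i => Finset.univ.filter fun p =>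
    p.1 ∈ (heavyRows m bad i \ heavyRows m bad (i + 1)) ∧ bad (i + 1) p.1 p.2
  have hsub : (Finset.univ.filter fun p : Fin n × Fin n => ¬ (t p.1 < m ∧ s p.2 < m ∧
        t p.1 ≤ s p.2 ∧ p.1 ∉ heavyRows m bad (t p.1) ∧ p.2 ∉ heavyCols bad (s p.2) ∧
        ¬ bad (t p.1) p.1 p.2)) ⊆
      E1 ∪ (E2 ∪ (E3 ∪ (Finset.range (m - 1)).biUnion fun i => E4 i ∪ E5 i)) := by
    rintro ⟨x, y⟩ hp
    simp only [Finset.mem_filter, Finset.mem_univ, true_and] at hp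
    simp only [E1, E2, E3, E4, E5, Finset.mem_union, Finset.mem_product, Finset.mem_univ,
      and_true, true_and, Finset.mem_filter, Finset.mem_sdiff, Finset.mem_biUnion,
      Finset.mem_range]
    rcases ht x with hx | ⟨htm, hxt, hxm⟩
    · exact Or.inl hx
    rcases hs y with hy | ⟨hsm, hys, hym⟩
    · exact Or.inr (Or.inl hy)
    refine Or.inr (Or.inr ?_)
    by_cases hts : t x ≤ s y
    · have hb : bad (t x) x y := by
        by_contra hb
        exact hp ⟨htm, hsm, hts, hxt, hys, hb⟩
      rcases Nat.eq_zero_or_pos (t x) with h0 | h0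
      · rw [h0] at hb hxt
        exact Or.inl ⟨hxt, hb⟩
      · refine Or.inr ⟨t x - 1, by omega, Or.inr ⟨⟨hxm _ (by omega), ?_⟩, ?_⟩⟩
        · rwa [Nat.sub_add_cancel h0]
        · rwa [Nat.sub_add_cancel h0]
    · refine Or.inr ⟨t x - 1, by omega, Or.inl ⟨hxm _ (by omega), ?_⟩⟩
      exact hym _ (by omega) (by omega)
  have hlight : ∀ i, ∀ x, x ∉ heavyRows m bad i →
      ((Finset.univ.filter fun y => bad i x y).card : ℝ) ≤ n * 2 ^ (i + 1) / (16 * 2 ^ m) := by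
    intro i x hx
    simp only [heavyRows, Finset.mem_filter, Finset.mem_univ, true_and, not_le] at hx
    exact hx.le
  have h1 : (E1.card : ℝ) ≤ N / 16 := by
    have := hr (m - 1) (by omega)
    rw [Nat.sub_add_cancel hm] at this
    simp only [E1, Finset.card_product, Finset.card_univ, Fintype.card_fin, Nat.cast_mul]
    calc _ ≤ (n : ℝ) / (16 * 2 ^ m) * n := by gcongr
      _ = N / 16 := by rw [hN]; field_simp
  have h2 : (E2.card : ℝ) ≤ N / 8 := by
    have := hc 0 (by omega)
    simp only [E2, Finset.card_product, Finset.card_univ, Fintype.card_fin, Nat.cast_mul]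
    calc _ ≤ (n : ℝ) * (n * 2 ^ (0 + 1) / (16 * 2 ^ m)) := by gcongr
      _ = N / 8 := by rw [hN]; field_simp; ring
  have h3 : (E3.card : ℝ) ≤ N / 8 := by
    have := card_filter_pairs_le (Finset.univ \ heavyRows m bad 0) (bad 0)
      (fun x hx => hlight 0 x (by simpa using hx))
    refine this.trans ?_
    have hcard : (((Finset.univ \ heavyRows m bad 0).card : ℕ) : ℝ) ≤ n := by
      exact_mod_cast (Finset.card_le_univ _).trans_eq (Fintype.card_fin n)
    calc _ ≤ (n : ℝ) * (n * 2 ^ (0 + 1) / (16 * 2 ^ m)) := by gcongr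
      _ = N / 8 := by rw [hN]; field_simp; ring
  -- The row and column thresholds are balanced so that 2 ^ i cancels and each level costs the same.
  have hprod : ∀ i : ℕ, (n : ℝ) / (16 * 2 ^ (i + 1)) * (n * 2 ^ (i + 1 + 1) / (16 * 2 ^ m)) =
      N / 128 := by
    intro i
    rw [hN]
    field_simp
    ring
  have h4 : ∀ i ∈ Finset.range (m - 1), ((E4 i).card : ℝ) ≤ N / 128 := by
    intro i hi
    rw [Finset.mem_range] at hi
    simp only [E4, Finset.card_product, Nat.cast_mul]
    rw [← hprod i]
    exact mul_le_mul (hr i (by omega)) (hc (i + 1) (by omega)) (by positivity) (by positivity)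
  have h5 : ∀ i ∈ Finset.range (m - 1), ((E5 i).card : ℝ) ≤ N / 128 := by
    intro i hi
    rw [Finset.mem_range] at hi
    refine (card_filter_pairs_le _ (bad (i + 1)) (fun x hx => hlight (i + 1) x
      (Finset.mem_sdiff.1 hx).2)).trans ?_
    rw [← hprod i]
    refine mul_le_mul_of_nonneg_right (le_trans ?_ (hr i (by omega))) (by positivity)
    exact_mod_cast Finset.card_le_card Finset.sdiff_subset
  have h6 : ((((Finset.range (m - 1)).biUnion fun i => E4 i ∪ E5 i).card : ℕ) : ℝ) ≤
      (m - 1) * (N / 64) := by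
    calc _ ≤ ((∑ i ∈ Finset.range (m - 1), (E4 i ∪ E5 i).card : ℕ) : ℝ) := by
          exact_mod_cast Finset.card_biUnion_le
      _ ≤ ∑ i ∈ Finset.range (m - 1), N / 64 := by
          push_cast
          refine Finset.sum_le_sum fun i hi => ?_
          have : (((E4 i ∪ E5 i).card : ℕ) : ℝ) ≤ (E4 i).card + (E5 i).card := by
            exact_mod_cast Finset.card_union_le _ _
          linarith [h4 i hi, h5 i hi]
      _ = (m - 1) * (N / 64) := by
          rw [Finset.sum_const, Finset.card_range, nsmul_eq_mul, Nat.cast_sub hm, Nat.cast_one]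
  have hcard := (Finset.card_le_card hsub).trans ((Finset.card_union_le _ _).trans
    (Nat.add_le_add_left ((Finset.card_union_le _ _).trans
    (Nat.add_le_add_left (Finset.card_union_le _ _) _)) _))
  have hcard' : _ ≤ ((E1.card + (E2.card + (E3.card +
    ((Finset.range (m - 1)).biUnion fun i => E4 i ∪ E5 i).card)) : ℕ) : ℝ) := Nat.cast_le.2 hcard
  refine hcard'.trans ?_
  push_cast
  nlinarith [h1, h2, h3, h6]

end Counting

/-! ### Farness forces a level with many bad entries. -/

section Progress

variable {F : Type*} [Field F] {n : ℕ}

/-- There is a matrix of rank at most `d` that agrees with `A` on the first `m` blocks. -/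
def Completable (A : Matrix (Fin n) (Fin n) F) (d m : ℕ) (R C : ℕ → Finset (Fin n)) : Prop :=
  ∃ M : Matrix (Fin n) (Fin n) F, M.rank ≤ d ∧ ∀ i < m, ∀ x ∈ R i, ∀ y ∈ C i, M x y = A x y

theorem Completable.anti {A : Matrix (Fin n) (Fin n) F} {d m : ℕ} {R R' C C' : ℕ → Finset (Fin n)}
    (h : Completable A d m R' C') (hR : ∀ i < m, R i ⊆ R' i) (hC : ∀ i < m, C i ⊆ C' i) :
    Completable A d m R C := by
  obtain ⟨M, hM, h⟩ := h
  exact ⟨M, hM, fun i hi x hx y hy => h i hi x (hR i hi hx) y (hC i hi hy)⟩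

/-- If the observed entries can be completed to a matrix of rank at most `d` although `A` is far
from rank `d`, then at some level many rows or many columns have many bad entries. -/
theorem exists_heavy {A : Matrix (Fin n) (Fin n) F} {d m : ℕ} (hm : 1 ≤ m)
    (hA : ∀ B : Matrix (Fin n) (Fin n) F, B.rank ≤ d →
      (5 / 16 + ((m : ℝ) - 1) / 64) * ((n : ℝ) ^ 2 / 2 ^ m) <
        ({p : Fin n × Fin n | A p.1 p.2 ≠ B p.1 p.2}.ncard : ℝ))
    {R C : ℕ → Finset (Fin n)} (hR : Monotone R) (hC : Antitone C)
    (h : Completable A d m R C) :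
    ∃ i < m, (n : ℝ) / (16 * 2 ^ (i + 1)) <
        (heavyRows m (fun i => Bad A (R i) (C i)) i).card ∨
      (n : ℝ) * 2 ^ (i + 1) / (16 * 2 ^ m) < (heavyCols (fun i => Bad A (R i) (C i)) i).card := by
  classical
  by_contra! hcon
  obtain ⟨M, hMd, hM⟩ := h
  obtain ⟨t, s, hts⟩ := card_exceptional_le hm (fun i => Bad A (R i) (C i))
    (fun i hi => (hcon i hi).1) (fun i hi => (hcon i hi).2)
  obtain ⟨B, hBM, hB⟩ := exists_extension hR hC hM t s
  refine absurd (hA B (hBM.trans hMd)) (not_lt.2 (le_trans ?_ hts))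
  rw [← Set.ncard_coe_finset]
  refine Nat.cast_le.2 (Set.ncard_le_ncard ?_ (Finset.finite_toSet _))
  rintro ⟨x, y⟩ hxy
  simp only [Finset.coe_filter, Finset.mem_univ, true_and, Set.mem_ofPred_eq] at hxy ⊢
  rintro ⟨htm, hsm, hts, hx, hy, hb⟩
  refine hxy (hB x y htm hts ?_ ?_ hb).symm
  -- If row x were not spanned, every entry in it would be bad, so the row would be heavy. The
  -- column case below is dual.
  · by_contra hsp
    refine hx ?_
    simp only [heavyRows, Finset.mem_filter, Finset.mem_univ, true_and]
    rw [Finset.filter_true_of_mem, Finset.card_univ, Fintype.card_fin]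
    · have : (2 : ℝ) ^ (t x + 1) ≤ 2 ^ m := pow_le_pow_right₀ (by norm_num) htm
      rw [div_le_iff₀ (by positivity)]
      have hn : (0 : ℝ) ≤ n := by positivity
      nlinarith [mul_le_mul_of_nonneg_left this hn, mul_nonneg hn (by positivity : (0:ℝ) ≤ 2 ^ m)]
    · intro z _
      by_contra hz
      exact hsp ((rowSpanned_insert_of_not_bad hz).mono (Finset.subset_insert _ _))
  · by_contra hsp
    refine hy ?_
    simp only [heavyCols, Finset.mem_filter, Finset.mem_univ, true_and]
    rw [Finset.filter_true_of_mem, Finset.card_univ, Fintype.card_fin]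
    · refine div_le_self (by positivity) ?_
      have : (1 : ℝ) ≤ 2 ^ (s y + 1) := one_le_pow₀ (by norm_num)
      linarith
    · intro z _
      by_contra hz
      exact hsp ((rowSpanned_insert_of_not_bad (mt bad_transpose.1 hz)).mono
        (Finset.subset_insert _ _))

end Progress

/-! ### Sampling with replacement; probabilities appear as unnormalised counts. -/

section Sampling

theorem ite_one_zero_le {p q : Prop} [Decidable p] [Decidable q] (h : p → q) :
    (if p then (1 : ℝ) else 0) ≤ if q then 1 else 0 := by
  by_cases hp : p
  · rw [if_pos hp, if_pos (h hp)]
  · rw [if_neg hp]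
    split_ifs <;> norm_num

variable {n : ℕ}

/-- The values of the first `a` members of the sample `f`. -/
def sampleSet {w : ℕ} (a : ℕ) (f : Fin w → Fin n) : Finset (Fin n) :=
  (Finset.univ.filter fun p : Fin w => p.val < a).image f

theorem mem_sampleSet {w a : ℕ} {f : Fin w → Fin n} {x : Fin n} :
    x ∈ sampleSet a f ↔ ∃ p : Fin w, p.val < a ∧ f p = x := by
  simp [sampleSet]

theorem sampleSet_mono {w a b : ℕ} (h : a ≤ b) (f : Fin w → Fin n) :
    sampleSet a f ⊆ sampleSet b f := by
  intro x
  simp only [mem_sampleSet]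
  rintro ⟨p, hp, hx⟩
  exact ⟨p, hp.trans_le h, hx⟩

theorem card_sampleSet_le {w a : ℕ} (f : Fin w → Fin n) : (sampleSet a f).card ≤ a := by
  refine Finset.card_image_le.trans ?_
  rw [Fin.card_filter_val_lt]
  exact min_le_right _ _

open Classical in
-- The a draws avoid H independently, each with probability at most 1 - h ≤ exp(-h); the other w - a
-- draws are free.
theorem sum_disjoint_sampleSet_le {w a : ℕ} (ha : a ≤ w) (H : Finset (Fin n)) {h : ℝ}
    (hH : h * n ≤ H.card) :
    (∑ f : Fin w → Fin n, if Disjoint (sampleSet a f) H then (1 : ℝ) else 0) ≤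
      Real.exp (-(h * a)) * (n : ℝ) ^ w := by
  have hset : (Finset.univ.filter fun f : Fin w → Fin n => Disjoint (sampleSet a f) H) =
      Fintype.piFinset fun p : Fin w => if p.val < a then Hᶜ else Finset.univ := by
    ext f
    simp only [Finset.mem_filter, Finset.mem_univ, true_and, Fintype.mem_piFinset,
      Finset.disjoint_left, mem_sampleSet]
    constructor
    · intro hf p
      split_ifs with hp
      · exact Finset.mem_compl.2 (hf ⟨p, hp, rfl⟩)
      · exact Finset.mem_univ _
    · rintro hf _ ⟨p, hp, rfl⟩
      have := hf p
      rw [if_pos hp] at this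
      exact Finset.mem_compl.1 this
  rw [Finset.sum_boole, hset, Fintype.card_piFinset]
  have hprod : (∏ p : Fin w, (if p.val < a then Hᶜ else Finset.univ).card) =
      (n - H.card) ^ a * n ^ (w - a) := by
    have : ∀ p : Fin w, (if p.val < a then Hᶜ else Finset.univ : Finset (Fin n)).card =
        if p.val < a then n - H.card else n := by
      intro p
      split_ifs
      · rw [Finset.card_compl, Fintype.card_fin]
      · rw [Finset.card_univ, Fintype.card_fin]
    rw [Finset.prod_congr rfl fun p _ => this p, Finset.prod_ite, Finset.prod_const,
      Finset.prod_const, Fin.card_filter_val_lt, min_eq_right ha]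
    congr 2
    have h1 := Finset.card_filter_add_card_filter_not (s := (Finset.univ : Finset (Fin w)))
      (fun p => p.val < a)
    rw [Fin.card_filter_val_lt, min_eq_right ha, Finset.card_univ, Fintype.card_fin] at h1
    omega
  rw [hprod]
  have hHn : H.card ≤ n := (Finset.card_le_univ H).trans_eq (Fintype.card_fin n)
  push_cast [Nat.cast_sub hHn]
  have h0 : (0 : ℝ) ≤ n - H.card := by
    have : (H.card : ℝ) ≤ n := by exact_mod_cast hHn
    linarith
  have h1 : (n : ℝ) - H.card ≤ Real.exp (-h) * n := by
    have := Real.add_one_le_exp (-h)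
    have := mul_le_mul_of_nonneg_right this (Nat.cast_nonneg n : (0 : ℝ) ≤ n)
    linarith
  calc ((n : ℝ) - H.card) ^ a * (n : ℝ) ^ (w - a)
      ≤ (Real.exp (-h) * n) ^ a * (n : ℝ) ^ (w - a) := by gcongr
    _ = Real.exp (-(h * a)) * (n : ℝ) ^ w := by
        rw [mul_pow, mul_assoc, ← pow_add, Nat.add_sub_cancel' ha, ← Real.exp_nat_mul]
        congr 2
        ring

open Classical in
-- Either the rows miss H, or some sampled row x in H is fixed and the columns must miss its many
-- partners y.
theorem sum_no_hit_le {w a b : ℕ} (ha : a ≤ w) (hb : b ≤ w) (P : Fin n → Fin n → Prop)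
    (H : Finset (Fin n)) {h k δ : ℝ} (hH : h * n ≤ H.card)
    (hP : ∀ x ∈ H, k * n ≤ (Finset.univ.filter fun y => P x y).card)
    (hδ : Real.exp (-(h * a)) + Real.exp (-(k * b)) ≤ δ) :
    (∑ f : Fin w → Fin n, ∑ g : Fin w → Fin n,
      if ∀ x ∈ sampleSet a f, ∀ y ∈ sampleSet b g, ¬ P x y then (1 : ℝ) else 0) ≤
      δ * ((n : ℝ) ^ w * (n : ℝ) ^ w) := by
  have hW : (Fintype.card (Fin w → Fin n) : ℝ) = (n : ℝ) ^ w := by simp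
  have key : ∀ f : Fin w → Fin n, (∑ g : Fin w → Fin n,
      if ∀ x ∈ sampleSet a f, ∀ y ∈ sampleSet b g, ¬ P x y then (1 : ℝ) else 0) ≤
      (if Disjoint (sampleSet a f) H then (1 : ℝ) else 0) * (n : ℝ) ^ w +
        Real.exp (-(k * b)) * (n : ℝ) ^ w := by
    intro f
    split_ifs with hf
    · have h1 : (∑ g : Fin w → Fin n,
          if ∀ x ∈ sampleSet a f, ∀ y ∈ sampleSet b g, ¬ P x y then (1 : ℝ) else 0) ≤
          ∑ g : Fin w → Fin n, 1 := Finset.sum_le_sum fun g _ => by split_ifs <;> norm_num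
      rw [Finset.sum_const, nsmul_one, Finset.card_univ, hW] at h1
      have : 0 ≤ Real.exp (-(k * b)) * (n : ℝ) ^ w := by positivity
      linarith
    · obtain ⟨x, hx, hxH⟩ := Finset.not_disjoint_iff.1 hf
      rw [zero_mul, zero_add]
      refine le_trans (Finset.sum_le_sum fun g _ => ite_one_zero_le fun h1 => ?_)
        (sum_disjoint_sampleSet_le hb (Finset.univ.filter fun y => P x y) (hP x hxH))
      exact Finset.disjoint_left.2 fun y hy hy' => h1 x hx y hy (Finset.mem_filter.1 hy').2
  refine (Finset.sum_le_sum fun f _ => key f).trans ?_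
  rw [Finset.sum_add_distrib, ← Finset.sum_mul, Finset.sum_const, Finset.card_univ, nsmul_eq_mul,
    hW]
  have h1 := mul_le_mul_of_nonneg_right (sum_disjoint_sampleSet_le ha H hH)
    (by positivity : (0 : ℝ) ≤ (n : ℝ) ^ w)
  have h2 := mul_le_mul_of_nonneg_right hδ (by positivity : (0 : ℝ) ≤ (n : ℝ) ^ w * (n : ℝ) ^ w)
  nlinarith [h1, h2]

end Sampling

/-! ### Rounds of sampling and growth of the block ranks. -/

section Rounds

variable {n : ℕ}

/-- One round of sampling: a sequence of rows and a sequence of columns. -/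
abbrev Round (n w : ℕ) : Type := (Fin w → Fin n) × (Fin w → Fin n)

/-- The row sets after the rounds `g`: level `i` uses the first `q 2 ^ (i + 1)` rows of a round. -/
def grownRows {w N : ℕ} (q : ℕ) (R : ℕ → Finset (Fin n)) (g : Fin N → Round n w) (i : ℕ) :
    Finset (Fin n) :=
  R i ∪ Finset.univ.biUnion fun l => sampleSet (q * 2 ^ (i + 1)) (g l).1

/-- The column sets after the rounds `g`: level `i` uses the first `q 2 ^ (m - 1 - i)` columns of a
round. -/
def grownCols {w N : ℕ} (q m : ℕ) (C : ℕ → Finset (Fin n)) (g : Fin N → Round n w) (i : ℕ) :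
    Finset (Fin n) :=
  C i ∪ Finset.univ.biUnion fun l => sampleSet (q * 2 ^ (m - 1 - i)) (g l).2

theorem subset_grownRows {w N q : ℕ} (R : ℕ → Finset (Fin n)) (g : Fin N → Round n w) (i : ℕ) :
    R i ⊆ grownRows q R g i := Finset.subset_union_left

theorem subset_grownCols {w N q m : ℕ} (C : ℕ → Finset (Fin n)) (g : Fin N → Round n w) (i : ℕ) :
    C i ⊆ grownCols q m C g i := Finset.subset_union_left

theorem grownRows_mono {w N q : ℕ} {R : ℕ → Finset (Fin n)} (hR : Monotone R)
    (g : Fin N → Round n w) : Monotone (grownRows q R g) := fun _ _ hij =>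
  Finset.union_subset_union (hR hij) (Finset.biUnion_mono fun _ _ => sampleSet_mono
    (Nat.mul_le_mul_left q (Nat.pow_le_pow_right two_pos (by omega))) _)

theorem grownCols_anti {w N q m : ℕ} {C : ℕ → Finset (Fin n)} (hC : Antitone C)
    (g : Fin N → Round n w) : Antitone (grownCols q m C g) := fun _ _ hij =>
  Finset.union_subset_union (hC hij) (Finset.biUnion_mono fun _ _ => sampleSet_mono
    (Nat.mul_le_mul_left q (Nat.pow_le_pow_right two_pos (by omega))) _)

theorem grownRows_cons {w N q : ℕ} (R : ℕ → Finset (Fin n)) (r : Round n w)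
    (g : Fin N → Round n w) :
    grownRows q R (Fin.cons r g : Fin (N + 1) → Round n w) =
      grownRows q (grownRows q R fun _ : Fin 1 => r) g := by
  ext i x
  simp [grownRows, Fin.exists_fin_succ]

theorem grownCols_cons {w N q m : ℕ} (C : ℕ → Finset (Fin n)) (r : Round n w)
    (g : Fin N → Round n w) :
    grownCols q m C (Fin.cons r g : Fin (N + 1) → Round n w) =
      grownCols q m (grownCols q m C fun _ : Fin 1 => r) g := by
  ext i x
  simp [grownCols, Fin.exists_fin_succ]

variable {F : Type*} [Field F]

/-- The sum of the ranks of the first `m` blocks. -/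
noncomputable def rankSum (A : Matrix (Fin n) (Fin n) F) (m : ℕ) (R C : ℕ → Finset (Fin n)) : ℕ :=
  ∑ i ∈ Finset.range m, (mask A (R i) (C i)).rank

theorem Completable.rankSum_le {A : Matrix (Fin n) (Fin n) F} {d m : ℕ}
    {R C : ℕ → Finset (Fin n)} (h : Completable A d m R C) : rankSum A m R C ≤ d * m := by
  obtain ⟨M, hM, h⟩ := h
  refine (Finset.sum_le_card_nsmul _ _ d fun i hi => ?_).trans (by simp [mul_comm])
  exact (rank_mask_le_of_agree (h i (Finset.mem_range.1 hi))).trans hM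

theorem rankSum_lt_of_bad {A : Matrix (Fin n) (Fin n) F} {m i : ℕ} (hi : i < m)
    {R R' C C' : ℕ → Finset (Fin n)} (hR : ∀ i, R i ⊆ R' i) (hC : ∀ i, C i ⊆ C' i) {x y : Fin n}
    (hx : x ∈ R' i) (hy : y ∈ C' i) (h : Bad A (R i) (C i) x y) :
    rankSum A m R C < rankSum A m R' C' :=
  Finset.sum_lt_sum (fun j _ => rank_mask_mono A (hR j) (hC j)) ⟨i, Finset.mem_range.2 hi,
    lt_of_lt_of_le h (rank_mask_mono A (Finset.insert_subset hx (hR i))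
      (Finset.insert_subset hy (hC i)))⟩

open Classical in
/-- While a completion of small rank exists, one round of sampling raises the sum of the ranks of
the blocks with high probability. -/
theorem sum_no_progress_le {A : Matrix (Fin n) (Fin n) F} {d m q : ℕ} (hm : 1 ≤ m)
    (hA : ∀ B : Matrix (Fin n) (Fin n) F, B.rank ≤ d →
      (5 / 16 + ((m : ℝ) - 1) / 64) * ((n : ℝ) ^ 2 / 2 ^ m) <
        ({p : Fin n × Fin n | A p.1 p.2 ≠ B p.1 p.2}.ncard : ℝ))
    {R C : ℕ → Finset (Fin n)} (hR : Monotone R) (hC : Antitone C)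
    (h : Completable A d m R C) :
    (∑ r : Round n (q * 2 ^ m),
      if rankSum A m (grownRows q R fun _ : Fin 1 => r) (grownCols q m C fun _ : Fin 1 => r) ≤
        rankSum A m R C then (1 : ℝ) else 0) ≤
      2 * Real.exp (-(q / 16)) *
        ((n : ℝ) ^ (q * 2 ^ m) * (n : ℝ) ^ (q * 2 ^ m)) := by
  obtain ⟨i, hi, hheavy⟩ := exists_heavy hm hA hR hC h
  have ha : q * 2 ^ (i + 1) ≤ q * 2 ^ m :=
    Nat.mul_le_mul_left q (Nat.pow_le_pow_right two_pos hi)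
  have hb : q * 2 ^ (m - 1 - i) ≤ q * 2 ^ m :=
    Nat.mul_le_mul_left q (Nat.pow_le_pow_right two_pos (by omega))
  -- The sample sizes of level i are inverse to the heaviness thresholds, so both exponents equal q
  -- / 16.
  have hexp1 : (1 : ℝ) / (16 * 2 ^ (i + 1)) * ((q * 2 ^ (i + 1) : ℕ) : ℝ) = q / 16 := by
    push_cast
    field_simp
  have hexp2 : (2 : ℝ) ^ (i + 1) / (16 * 2 ^ m) * ((q * 2 ^ (m - 1 - i) : ℕ) : ℝ) = q / 16 := by
    have : (2 : ℝ) ^ m = 2 ^ (i + 1) * 2 ^ (m - 1 - i) := by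
      rw [← pow_add]
      congr 1
      omega
    push_cast
    rw [this]
    field_simp
  rw [Fintype.sum_prod_type]
  have hmem : ∀ f g : Fin (q * 2 ^ m) → Fin n,
      rankSum A m (grownRows q R fun _ : Fin 1 => (f, g))
        (grownCols q m C fun _ : Fin 1 => (f, g)) ≤ rankSum A m R C →
      ∀ x ∈ sampleSet (q * 2 ^ (i + 1)) f, ∀ y ∈ sampleSet (q * 2 ^ (m - 1 - i)) g,
        ¬ Bad A (R i) (C i) x y := by
    intro f g hle x hx y hy hbad
    refine absurd (rankSum_lt_of_bad hi (subset_grownRows (q := q) R fun _ : Fin 1 => (f, g))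
      (subset_grownCols (q := q) (m := m) C fun _ : Fin 1 => (f, g)) ?_ ?_ hbad) (not_lt.2 hle)
    · exact Finset.mem_union_right _ (Finset.mem_biUnion.2 ⟨0, Finset.mem_univ _, hx⟩)
    · exact Finset.mem_union_right _ (Finset.mem_biUnion.2 ⟨0, Finset.mem_univ _, hy⟩)
  rcases hheavy with hH | hH
  · refine le_trans (Finset.sum_le_sum fun f _ => Finset.sum_le_sum fun g _ =>
        ite_one_zero_le (hmem f g))
      (sum_no_hit_le ha hb (Bad A (R i) (C i)) (heavyRows m (fun i => Bad A (R i) (C i)) i)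
        (h := 1 / (16 * 2 ^ (i + 1))) (k := 2 ^ (i + 1) / (16 * 2 ^ m)) ?_ ?_ ?_)
    · refine le_trans (le_of_eq ?_) hH.le
      ring
    · intro x hx
      simp only [heavyRows, Finset.mem_filter, Finset.mem_univ, true_and] at hx
      refine le_trans (le_of_eq ?_) hx
      ring
    · rw [hexp1, hexp2, two_mul]
  -- For heavy columns the roles swap: first hit a heavy column, then a bad row in it.
  · rw [Finset.sum_comm]
    refine le_trans (Finset.sum_le_sum fun g _ => Finset.sum_le_sum fun f _ =>
        ite_one_zero_le (fun h1 y hy x hx => hmem f g h1 x hx y hy))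
      (sum_no_hit_le hb ha (fun y x => Bad A (R i) (C i) x y)
        (heavyCols (fun i => Bad A (R i) (C i)) i)
        (h := 2 ^ (i + 1) / (16 * 2 ^ m)) (k := 1 / (16 * 2 ^ (i + 1))) ?_ ?_ ?_)
    · refine le_trans (le_of_eq ?_) hH.le
      ring
    · intro x hx
      simp only [heavyCols, Finset.mem_filter, Finset.mem_univ, true_and] at hx
      refine le_trans (le_of_eq ?_) hx
      ring
    · rw [hexp1, hexp2, two_mul]

open Classical in
-- Induction on the rounds left, with d m - `rankSum` as the budget of possible increases. The first
-- round either fails to raise the sum, at cost 2 exp(-q/16), or leaves a situation covered by N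
-- rounds. With no round left the sum exceeds d m, so no completion exists.
theorem sum_completable_le {A : Matrix (Fin n) (Fin n) F} {d m q : ℕ} (hm : 1 ≤ m)
    (hA : ∀ B : Matrix (Fin n) (Fin n) F, B.rank ≤ d →
      (5 / 16 + ((m : ℝ) - 1) / 64) * ((n : ℝ) ^ 2 / 2 ^ m) <
        ({p : Fin n × Fin n | A p.1 p.2 ≠ B p.1 p.2}.ncard : ℝ)) (N : ℕ) :
    ∀ R C : ℕ → Finset (Fin n), Monotone R → Antitone C → d * m < rankSum A m R C + N →
    (∑ g : Fin N → Round n (q * 2 ^ m),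
      if Completable A d m (grownRows q R g) (grownCols q m C g) then (1 : ℝ) else 0) ≤
      N * (2 * Real.exp (-(q / 16))) * (Fintype.card (Round n (q * 2 ^ m)) : ℝ) ^ N := by
  induction N with
  | zero =>
    intro R C _ _ h
    refine (Finset.sum_eq_zero fun g _ => if_neg fun hg => ?_).trans_le (by simp)
    have := (hg.anti (fun i _ => subset_grownRows R g i)
      (fun i _ => subset_grownCols C g i)).rankSum_le
    omega
  | succ N ih =>
    intro R C hR hC h
    set δ : ℝ := 2 * Real.exp (-(q / 16)) with hδ
    have hδ0 : 0 ≤ δ := by positivity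
    set W : ℝ := (Fintype.card (Round n (q * 2 ^ m)) : ℝ) with hW
    have hW0 : 0 ≤ W := by positivity
    by_cases hc : Completable A d m R C
    · have hprog := sum_no_progress_le (q := q) hm hA hR hC hc
      have hWn : (n : ℝ) ^ (q * 2 ^ m) * (n : ℝ) ^ (q * 2 ^ m) = W := by simp [hW]
      rw [hWn, ← hδ] at hprog
      rw [← (Fin.consEquiv fun _ => Round n (q * 2 ^ m)).sum_comp, Fintype.sum_prod_type]
      have key : ∀ r : Round n (q * 2 ^ m), (∑ g : Fin N → Round n (q * 2 ^ m),
          if Completable A d m (grownRows q R (Fin.consEquiv (fun _ => Round n (q * 2 ^ m)) (r, g)))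
            (grownCols q m C (Fin.consEquiv (fun _ => Round n (q * 2 ^ m)) (r, g)))
          then (1 : ℝ) else 0) ≤
          (if rankSum A m (grownRows q R fun _ : Fin 1 => r)
            (grownCols q m C fun _ : Fin 1 => r) ≤ rankSum A m R C then (1 : ℝ) else 0) * W ^ N +
          N * δ * W ^ N := by
        intro r
        have hcons : ∀ g : Fin N → Round n (q * 2 ^ m),
            Fin.consEquiv (fun _ => Round n (q * 2 ^ m)) (r, g) = Fin.cons r g := fun _ => rfl
        simp only [hcons, grownRows_cons, grownCols_cons]
        have hpos : 0 ≤ N * δ * W ^ N := by positivity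
        split_ifs with hle
        · have h1 : (∑ g : Fin N → Round n (q * 2 ^ m),
              if Completable A d m (grownRows q (grownRows q R fun _ : Fin 1 => r) g)
                (grownCols q m (grownCols q m C fun _ : Fin 1 => r) g)
              then (1 : ℝ) else 0) ≤ ∑ g : Fin N → Round n (q * 2 ^ m), 1 :=
            Finset.sum_le_sum fun g _ => by split_ifs <;> norm_num
          rw [Finset.sum_const, nsmul_one, Finset.card_univ] at h1
          have hcard : (Fintype.card (Fin N → Round n (q * 2 ^ m)) : ℝ) = W ^ N := by
            rw [Fintype.card_fun, Fintype.card_fin, Nat.cast_pow]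
          rw [hcard] at h1
          linarith
        · rw [zero_mul, zero_add]
          exact ih _ _ (grownRows_mono hR _) (grownCols_anti hC _) (by omega)
      refine (Finset.sum_le_sum fun r _ => key r).trans ?_
      rw [Finset.sum_add_distrib, ← Finset.sum_mul, Finset.sum_const, Finset.card_univ,
        nsmul_eq_mul, ← hW]
      have := mul_le_mul_of_nonneg_right hprog (by positivity : 0 ≤ W ^ N)
      push_cast
      rw [pow_succ]
      nlinarith [this]
    · refine (Finset.sum_eq_zero fun g _ => if_neg fun hg => hc ?_).trans_le (by positivity)
      exact hg.anti (fun i _ => subset_grownRows R g i) (fun i _ => subset_grownCols C g i)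

end Rounds

/-! ### From sampling with replacement to uniform nested blocks. -/

section Symmetrization

variable {n m : ℕ}

/-- A nested family of sets is, up to a permutation, a family of initial segments. -/
theorem exists_perm_initial_segments {S : Fin m → Finset (Fin n)} (hS : Monotone S) :
    ∃ σ : Equiv.Perm (Fin n), ∀ j,
      S j = (Finset.univ.filter fun p : Fin n => p.val < (S j).card).map σ.toEmbedding := by
  classical
  -- Sorting by the number of sets that miss a point makes each set of the chain an initial segment.
  let lev : Fin n → ℕ := fun x => (Finset.univ.filter fun j => x ∉ S j).card
  refine ⟨Tuple.sort lev, fun j => ?_⟩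
  have hlev : ∀ x y, lev x ≤ lev y → y ∈ S j → x ∈ S j := by
    intro x y hxy hy
    by_contra hx
    have hss : (Finset.univ.filter fun i => y ∉ S i) ⊂ Finset.univ.filter fun i => x ∉ S i := by
      refine Finset.ssubset_iff_subset_ne.2 ⟨fun i hi => ?_, fun h => ?_⟩
      · simp only [Finset.mem_filter, Finset.mem_univ, true_and] at hi ⊢
        rcases le_total i j with hij | hij
        · exact fun h => hx (hS hij h)
        · exact absurd (hS hij hy) hi
      · have : j ∈ Finset.univ.filter fun i => x ∉ S i := by simp [hx]
        rw [← h] at this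
        simp [hy] at this
    exact absurd (Finset.card_lt_card hss) (not_lt.2 hxy)
  set σ := Tuple.sort lev with hσ
  have hmono : Monotone (lev ∘ σ) := Tuple.monotone_sort lev
  set T : Finset (Fin n) := Finset.univ.filter fun p => σ p ∈ S j with hT
  have hmap : S j = T.map σ.toEmbedding := by
    ext x
    simp only [hT, Finset.mem_map, Finset.mem_filter, Finset.mem_univ, true_and,
      Equiv.coe_toEmbedding]
    exact ⟨fun hx => ⟨σ.symm x, by simpa using hx, by simp⟩, by rintro ⟨p, hp, rfl⟩; exact hp⟩
  have hcard : (S j).card = T.card := by rw [hmap, Finset.card_map]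
  have hlow : ∀ p p', p ≤ p' → p' ∈ T → p ∈ T := by
    intro p p' hp hp'
    simp only [hT, Finset.mem_filter, Finset.mem_univ, true_and] at hp' ⊢
    exact hlev _ _ (hmono hp) hp'
  rw [hcard]
  rw [hmap]
  congr 1
  ext p
  simp only [Finset.mem_filter, Finset.mem_univ, true_and]
  constructor
  · intro hp
    have : Finset.Iic p ⊆ T := fun p' hp' => hlow p' p (Finset.mem_Iic.1 hp') hp
    have := Finset.card_le_card this
    rw [Fin.card_Iic] at this
    omega
  · intro hp
    by_contra hpT
    have : T ⊆ Finset.Iio p := fun p' hp' => by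
      rw [Finset.mem_Iio]
      by_contra hlt
      exact hpT (hlow p p' (not_lt.1 hlt) hp')
    have := Finset.card_le_card this
    rw [Fin.card_Iio] at this
    omega

/-- Permute the rows and the columns of all blocks. -/
def permute (g : Equiv.Perm (Fin n) × Equiv.Perm (Fin n)) (ω : Blocks n m) : Blocks n m :=
  (fun j => (ω.1 j).map g.1.toEmbedding, fun j => (ω.2 j).map g.2.toEmbedding)

theorem permute_mul (g h : Equiv.Perm (Fin n) × Equiv.Perm (Fin n)) (ω : Blocks n m) :
    permute (g * h) ω = permute g (permute h ω) := by
  ext j x <;> simp only [permute, Finset.mem_map_equiv] <;> rfl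

theorem permute_one (ω : Blocks n m) : permute 1 ω = ω := by
  ext j x <;> simp only [permute, Finset.mem_map_equiv] <;> rfl

/-- Permuting the rows and the columns is a bijection of the set of all blocks. -/
def permuteEquiv (g : Equiv.Perm (Fin n) × Equiv.Perm (Fin n)) : Blocks n m ≃ Blocks n m where
  toFun := permute g
  invFun := permute g⁻¹
  left_inv ω := by rw [← permute_mul, inv_mul_cancel, permute_one]
  right_inv ω := by rw [← permute_mul, mul_inv_cancel, permute_one]

open Classical in
/-- The nested blocks with given numbers of rows and of columns. -/
noncomputable def nestedOfSizes (r c : Fin m → ℕ) : Finset (Blocks n m) :=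
  {ω | Monotone ω.1 ∧ Antitone ω.2 ∧ (∀ j, (ω.1 j).card = r j) ∧ ∀ j, (ω.2 j).card = c j}

theorem mem_nestedOfSizes {r c : Fin m → ℕ} {ω : Blocks n m} :
    ω ∈ nestedOfSizes r c ↔ Monotone ω.1 ∧ Antitone ω.2 ∧ (∀ j, (ω.1 j).card = r j) ∧
      ∀ j, (ω.2 j).card = c j := by
  simp [nestedOfSizes]

theorem permute_mem_nestedOfSizes {r c : Fin m → ℕ} {ω : Blocks n m}
    (g : Equiv.Perm (Fin n) × Equiv.Perm (Fin n)) (h : ω ∈ nestedOfSizes r c) :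
    permute g ω ∈ nestedOfSizes r c := by
  rw [mem_nestedOfSizes] at h ⊢
  refine ⟨fun i j hij => ?_, fun i j hij => ?_, fun j => ?_, fun j => ?_⟩
  · exact Finset.map_subset_map.2 (h.1 hij)
  · exact Finset.map_subset_map.2 (h.2.1 hij)
  · simpa [permute] using h.2.2.1 j
  · simpa [permute] using h.2.2.2 j

theorem permute_mem_nestedOfSizes_iff {r c : Fin m → ℕ} {ω : Blocks n m}
    (g : Equiv.Perm (Fin n) × Equiv.Perm (Fin n)) :
    permute g ω ∈ nestedOfSizes r c ↔ ω ∈ nestedOfSizes r c := by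
  refine ⟨fun h => ?_, permute_mem_nestedOfSizes g⟩
  have := permute_mem_nestedOfSizes g⁻¹ h
  rwa [← permute_mul, inv_mul_cancel, permute_one] at this

/-- The blocks that consist of initial segments. -/
def initialBlocks (r c : Fin m → ℕ) : Blocks n m :=
  (fun j => Finset.univ.filter fun p => p.val < r j,
    fun j => Finset.univ.filter fun p => p.val < c j)

theorem exists_permute_initialBlocks {ω : Blocks n m} (h1 : Monotone ω.1) (h2 : Antitone ω.2) :
    ∃ g, ω = permute g (initialBlocks (fun j => (ω.1 j).card) fun j => (ω.2 j).card) := by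
  obtain ⟨σ, hσ⟩ := exists_perm_initial_segments h1
  obtain ⟨τ, hτ⟩ := exists_perm_initial_segments (S := fun j => ω.2 j.rev)
    fun i j hij => h2 (Fin.rev_le_rev.2 hij)
  refine ⟨(σ, τ), Prod.ext (funext hσ) (funext fun j => ?_)⟩
  have := hτ j.rev
  simp only [Fin.rev_rev] at this
  exact this

open Classical in
-- All nested blocks of given sizes form one orbit, so a uniform pair of permutations applied to the
-- initial segments yields the uniform law. This is the cross-multiplied form, obtained by double
-- counting.
theorem card_mul_sum_permute {r c : Fin m → ℕ} (Z : Blocks n m → Prop) :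
    ((nestedOfSizes (n := n) r c).card : ℝ) *
      (∑ g : Equiv.Perm (Fin n) × Equiv.Perm (Fin n),
        if Z (permute g (initialBlocks r c)) then (1 : ℝ) else 0) =
      (Fintype.card (Equiv.Perm (Fin n) × Equiv.Perm (Fin n)) : ℝ) *
        ∑ ω ∈ nestedOfSizes (n := n) r c, if Z ω then (1 : ℝ) else 0 := by
  have h1 : ∀ ω ∈ nestedOfSizes (n := n) r c,
      (∑ g : Equiv.Perm (Fin n) × Equiv.Perm (Fin n), if Z (permute g ω) then (1 : ℝ) else 0) =
      ∑ g : Equiv.Perm (Fin n) × Equiv.Perm (Fin n),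
        if Z (permute g (initialBlocks r c)) then (1 : ℝ) else 0 := by
    intro ω hω
    rw [mem_nestedOfSizes] at hω
    obtain ⟨h, hh⟩ := exists_permute_initialBlocks hω.1 hω.2.1
    rw [funext hω.2.2.1, funext hω.2.2.2] at hh
    refine Eq.trans ?_ (Equiv.sum_comp (Equiv.mulRight h) fun g =>
      if Z (permute g (initialBlocks r c)) then (1 : ℝ) else 0)
    simp only [Equiv.coe_mulRight, permute_mul, ← hh]
  have h2 : ∀ g : Equiv.Perm (Fin n) × Equiv.Perm (Fin n),
      (∑ ω ∈ nestedOfSizes (n := n) r c, if Z (permute g ω) then (1 : ℝ) else 0) =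
      ∑ ω ∈ nestedOfSizes (n := n) r c, if Z ω then (1 : ℝ) else 0 := fun g =>
    Finset.sum_equiv (permuteEquiv g) (fun ω => (permute_mem_nestedOfSizes_iff g).symm)
      fun ω _ => rfl
  calc _ = ∑ ω ∈ nestedOfSizes (n := n) r c,
        ∑ g : Equiv.Perm (Fin n) × Equiv.Perm (Fin n),
          if Z (permute g ω) then (1 : ℝ) else 0 := by
        rw [Finset.sum_congr rfl h1, Finset.sum_const, nsmul_eq_mul]
    _ = _ := by
        rw [Finset.sum_comm, Finset.sum_congr rfl fun g _ => h2 g, Finset.sum_const, nsmul_eq_mul,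
          Finset.card_univ]

open Classical in
/-- Uniformly random nested blocks dominate random nested blocks that are smaller and whose
distribution is invariant under permutations. -/
theorem card_mul_sum_nested_le {Ω : Type*} [Fintype Ω] {r c : Fin m → ℕ} (Z : Blocks n m → Prop)
    (hZ : ∀ ω ω' : Blocks n m, (∀ j, ω.1 j ⊆ ω'.1 j) → (∀ j, ω.2 j ⊆ ω'.2 j) → Z ω' → Z ω)
    (S : Ω → Blocks n m)
    (e : Equiv.Perm (Fin n) × Equiv.Perm (Fin n) → Ω ≃ Ω)
    (he : ∀ g f, S (e g f) = permute g (S f)) (hS1 : ∀ f, Monotone (S f).1)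
    (hS2 : ∀ f, Antitone (S f).2) (hr : ∀ f j, ((S f).1 j).card ≤ r j)
    (hc : ∀ f j, ((S f).2 j).card ≤ c j) :
    (Fintype.card Ω : ℝ) * (∑ ω ∈ nestedOfSizes (n := n) r c, if Z ω then (1 : ℝ) else 0) ≤
      (nestedOfSizes (n := n) r c).card * ∑ f, if Z (S f) then (1 : ℝ) else 0 := by
  have hGpos : (0 : ℝ) < (Fintype.card (Equiv.Perm (Fin n) × Equiv.Perm (Fin n)) : ℝ) := by
    exact_mod_cast Fintype.card_pos
  have key : ∀ f, (∑ g : Equiv.Perm (Fin n) × Equiv.Perm (Fin n),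
          if Z (permute g (initialBlocks r c)) then (1 : ℝ) else 0) ≤
      ∑ g : Equiv.Perm (Fin n) × Equiv.Perm (Fin n), if Z (S (e g f)) then (1 : ℝ) else 0 := by
    intro f
    obtain ⟨h, hh⟩ := exists_permute_initialBlocks (hS1 f) (hS2 f)
    refine (Equiv.sum_comp (Equiv.mulRight h) fun g =>
      if Z (permute g (initialBlocks r c)) then (1 : ℝ) else 0).symm.trans_le ?_
    refine Finset.sum_le_sum fun g _ => ?_
    -- The same g * h carries the prescribed initial segments to a superset of the permuted sample,
    -- so Z passes down to the sample.
    have himp : Z (permute (g * h) (initialBlocks r c)) → Z (S (e g f)) := by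
      rw [he, hh, ← permute_mul]
      refine hZ _ _ (fun j => ?_) fun j => ?_
      · refine Finset.map_subset_map.2 fun p => ?_
        simp only [initialBlocks, Finset.mem_filter, Finset.mem_univ, true_and]
        exact fun hp => hp.trans_le (hr f j)
      · refine Finset.map_subset_map.2 fun p => ?_
        simp only [initialBlocks, Finset.mem_filter, Finset.mem_univ, true_and]
        exact fun hp => hp.trans_le (hc f j)
    exact ite_one_zero_le himp
  have hsum := Finset.sum_le_sum fun f (_ : f ∈ (Finset.univ : Finset Ω)) => key f
  have hinv : (∑ f, ∑ g : Equiv.Perm (Fin n) × Equiv.Perm (Fin n),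
      if Z (S (e g f)) then (1 : ℝ) else 0) =
      (Fintype.card (Equiv.Perm (Fin n) × Equiv.Perm (Fin n)) : ℝ) *
        ∑ f, if Z (S f) then (1 : ℝ) else 0 := by
    rw [Finset.sum_comm, Finset.sum_congr rfl fun g _ =>
      Equiv.sum_comp (e g) fun f => if Z (S f) then (1 : ℝ) else 0, Finset.sum_const,
      nsmul_eq_mul, Finset.card_univ]
  rw [hinv, Finset.sum_const, Finset.card_univ, nsmul_eq_mul] at hsum
  have hmul := mul_le_mul_of_nonneg_left hsum
    (Nat.cast_nonneg (nestedOfSizes (n := n) r c).card : (0 : ℝ) ≤ _)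
  have hT := card_mul_sum_permute (n := n) (r := r) (c := c) Z
  refine le_of_mul_le_mul_left ?_ hGpos
  calc _ = (Fintype.card Ω : ℝ) * ((Fintype.card (Equiv.Perm (Fin n) × Equiv.Perm (Fin n)) : ℝ) *
        ∑ ω ∈ nestedOfSizes (n := n) r c, if Z ω then (1 : ℝ) else 0) := by ring
    _ = (nestedOfSizes (n := n) r c).card * ((Fintype.card Ω : ℝ) *
        ∑ g : Equiv.Perm (Fin n) × Equiv.Perm (Fin n),
          if Z (permute g (initialBlocks r c)) then (1 : ℝ) else 0) := by
        rw [← hT]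
        ring
    _ ≤ _ := hmul
    _ = _ := by ring

end Symmetrization

/-! ### Completions on the sampled submatrix and on the whole matrix. -/

section Completion

variable {F : Type*} [Field F] {n m : ℕ}

/-- A matrix with rows `R` and columns `C` extends by zero without an increase of the rank. -/
theorem exists_extension_by_zero {R C : Finset (Fin n)} (M : Matrix R C F) :
    ∃ M' : Matrix (Fin n) (Fin n) F, M'.rank ≤ M.rank ∧
      ∀ (x : R) (y : C), M' x.1 y.1 = M x y := by
  refine ⟨(1 : Matrix (Fin n) (Fin n) F).submatrix id (Subtype.val : R → Fin n) * M *
    (1 : Matrix (Fin n) (Fin n) F).submatrix (Subtype.val : C → Fin n) id,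
    (Matrix.rank_mul_le_left _ _).trans (Matrix.rank_mul_le_right _ _), fun x y => ?_⟩
  have h1 : ∀ i : R, (x.1 = i.1) = (x = i) := fun i => by rw [Subtype.ext_iff]
  have h2 : ∀ i : C, (i.1 = y.1) = (i = y) := fun i => by rw [Subtype.ext_iff]
  simp [Matrix.mul_apply, Matrix.one_apply, h1, h2]

theorem minCompletionRank_le_rank (ω : Blocks n m) (A : Matrix (Fin n) (Fin n) F) :
    minCompletionRank ω (fun p => A p.1.1 p.1.2) ≤ A.rank := by
  refine le_trans (Nat.sInf_le ⟨A.submatrix Subtype.val Subtype.val, fun i j h => rfl, rfl⟩) ?_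
  exact Matrix.rank_submatrix_le A _ _

/-- There is a matrix of rank at most `d` that agrees with `A` on all blocks. -/
def BlocksCompletable (A : Matrix (Fin n) (Fin n) F) (d : ℕ) (ω : Blocks n m) : Prop :=
  ∃ M : Matrix (Fin n) (Fin n) F, M.rank ≤ d ∧ ∀ j, ∀ x ∈ ω.1 j, ∀ y ∈ ω.2 j, M x y = A x y

theorem blocksCompletable_of_minCompletionRank_le {ω : Blocks n m} {A : Matrix (Fin n) (Fin n) F}
    {d : ℕ} (h : minCompletionRank ω (fun p => A p.1.1 p.1.2) ≤ d) :
    BlocksCompletable A d ω := by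
  obtain ⟨M, hM, hr⟩ := Nat.sInf_mem (s := {r : ℕ | ∃ M : Matrix (sampledRows ω) (sampledCols ω) F,
    (∀ (i : sampledRows ω) (j : sampledCols ω) (h : (i.1, j.1) ∈ querySet ω),
      M i j = A i.1 j.1) ∧ M.rank = r})
    ⟨_, A.submatrix Subtype.val Subtype.val, fun i j h => rfl, rfl⟩
  obtain ⟨M', hM', hag⟩ := exists_extension_by_zero M
  refine ⟨M', hM'.trans (hr.trans_le h), fun j x hx y hy => ?_⟩
  have hx' : x ∈ sampledRows ω := Finset.mem_biUnion.2 ⟨j, Finset.mem_univ _, hx⟩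
  have hy' : y ∈ sampledCols ω := Finset.mem_biUnion.2 ⟨j, Finset.mem_univ _, hy⟩
  have hxy : (x, y) ∈ querySet ω :=
    Finset.mem_biUnion.2 ⟨j, Finset.mem_univ _, Finset.mem_product.2 ⟨hx, hy⟩⟩
  rw [hag ⟨x, hx'⟩ ⟨y, hy'⟩]
  exact hM ⟨x, hx'⟩ ⟨y, hy'⟩ hxy

end Completion

/-! ### The output distribution of the tester. -/

section FailureProbability

variable {F : Type*} [Field F] {n : ℕ}

open Classical in
theorem rankTester_rankAtMost (d : ℕ) (c η : ℝ) (A : Matrix (Fin n) (Fin n) F) :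
    rankTester d c η A Verdict.rankAtMost = ENNReal.ofReal
      ((∑ ω ∈ nestedBlocks n d c η,
        if minCompletionRank ω (fun p => A p.1.1 p.1.2) ≤ d then (1 : ℝ) else 0) /
        (nestedBlocks n d c η).card) := by
  have hpos : (0 : ℝ) < (nestedBlocks n d c η).card := by
    exact_mod_cast Finset.card_pos.2 (nestedBlocks_nonempty n d c η)
  rw [rankTester, PMF.map_apply, tsum_fintype, ENNReal.ofReal_div_of_pos hpos,
    ENNReal.ofReal_natCast, Finset.sum_boole, ENNReal.ofReal_natCast, div_eq_mul_inv,
    ← nsmul_eq_mul, ← Finset.sum_const, ← Finset.sum_filter, ← Finset.sum_filter_add_sum_filter_not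
      _ (fun ω => ω ∈ nestedBlocks n d c η)]
  have hz : ∀ s : Finset (Blocks n (numBlocks η)),
      (∑ ω ∈ s with ω ∉ nestedBlocks n d c η, blockLaw n d c η ω) = 0 := fun s =>
    Finset.sum_eq_zero fun ω hω => by
      rw [blockLaw, PMF.uniformOfFinset_apply, if_neg (Finset.mem_filter.1 hω).2]
  rw [hz, add_zero]
  refine Finset.sum_congr ?_ fun ω hω => ?_
  · ext ω
    simp only [Finset.mem_filter, decision]
    rw [and_comm]
    refine and_congr_right fun _ => ?_
    simp
  · rw [blockLaw, PMF.uniformOfFinset_apply, if_pos (Finset.mem_filter.1 hω).1]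

theorem rankTester_eq_one {d : ℕ} {c η : ℝ} {A : Matrix (Fin n) (Fin n) F} (hA : A.rank ≤ d) :
    rankTester d c η A Verdict.rankAtMost = 1 := by
  have hpos : (0 : ℝ) < (nestedBlocks n d c η).card := by
    exact_mod_cast Finset.card_pos.2 (nestedBlocks_nonempty n d c η)
  rw [rankTester_rankAtMost, Finset.sum_congr rfl fun ω _ =>
    if_pos ((minCompletionRank_le_rank ω A).trans hA), Finset.sum_const, nsmul_one,
    div_self hpos.ne', ENNReal.ofReal_one]

theorem rankTester_le {d q N : ℕ} {c η : ℝ} {A : Matrix (Fin n) (Fin n) F} (hn : 1 ≤ n)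
    (hm : 1 ≤ numBlocks η)
    (hA : ∀ B : Matrix (Fin n) (Fin n) F, B.rank ≤ d →
      (5 / 16 + ((numBlocks η : ℝ) - 1) / 64) * ((n : ℝ) ^ 2 / 2 ^ numBlocks η) <
        ({p : Fin n × Fin n | A p.1 p.2 ≠ B p.1 p.2}.ncard : ℝ))
    (hN : d * numBlocks η < N)
    (hr : ∀ j < numBlocks η, N * (q * 2 ^ (j + 1)) ≤ ⌈sizeFactor d c η * 2 ^ (j + 1)⌉₊)
    (hc : ∀ j < numBlocks η,
      N * (q * 2 ^ (numBlocks η - 1 - j)) ≤ ⌈sizeFactor d c η / (2 ^ (j + 1) * η)⌉₊) :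
    rankTester d c η A Verdict.rankAtMost ≤
      ENNReal.ofReal (N * (2 * Real.exp (-(q / 16)))) := by
  classical
  rw [rankTester_rankAtMost]
  refine ENNReal.ofReal_le_ofReal ?_
  have hne := nestedBlocks_nonempty n d c η
  have hpos : (0 : ℝ) < (nestedBlocks n d c η).card := by exact_mod_cast Finset.card_pos.2 hne
  rw [div_le_iff₀ hpos]
  set m := numBlocks η with hmdef
  set r : Fin m → ℕ := fun j => rowSize n d c η (j + 1) with hrdef
  set k : Fin m → ℕ := fun j => colSize n d c η (j + 1) with hkdef
  have hNB : nestedBlocks n d c η = nestedOfSizes r k := by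
    ext ω
    simp only [nestedBlocks, nestedOfSizes, Finset.mem_filter, hrdef, hkdef]
    exact Iff.rfl
  set Ω := Fin N → Round n (q * 2 ^ m) with hΩ
  -- The rounds start from empty sets; `hr` and `hc` make the union of N samples fit into each
  -- prescribed size.
  let S : Ω → Blocks n m := fun g =>
    (fun j => grownRows q (fun _ => ∅) g j, fun j => grownCols q m (fun _ => ∅) g j)
  let e : Equiv.Perm (Fin n) × Equiv.Perm (Fin n) → Ω ≃ Ω := fun p =>
    Equiv.piCongrRight fun _ =>
      (Equiv.piCongrRight fun _ => p.1).prodCongr (Equiv.piCongrRight fun _ => p.2)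
  have hcardS : ∀ a (f : Fin N → Fin (q * 2 ^ m) → Fin n),
      (Finset.univ.biUnion fun l => sampleSet a (f l)).card ≤ N * a := fun a f =>
    (Finset.card_biUnion_le.trans (Finset.sum_le_card_nsmul _ _ a fun l _ =>
      card_sampleSet_le _)).trans_eq (by simp)
  have hle := card_mul_sum_nested_le (Ω := Ω) (r := r) (c := k) (BlocksCompletable A d)
    (fun ω ω' h1 h2 ⟨M, hM, h⟩ =>
      ⟨M, hM, fun j x hx y hy => h j x (h1 j hx) y (h2 j hy)⟩) S e
    (fun g f => by
      ext j x
      · simp only [S, e, permute, grownRows, Finset.empty_union, Finset.mem_biUnion,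
          Finset.mem_map, mem_sampleSet, Finset.mem_univ, true_and]
        constructor
        · rintro ⟨l, p, hp, rfl⟩
          exact ⟨_, ⟨l, p, hp, rfl⟩, rfl⟩
        · rintro ⟨_, ⟨l, p, hp, rfl⟩, rfl⟩
          exact ⟨l, p, hp, rfl⟩
      · simp only [S, e, permute, grownCols, Finset.empty_union, Finset.mem_biUnion,
          Finset.mem_map, mem_sampleSet, Finset.mem_univ, true_and]
        constructor
        · rintro ⟨l, p, hp, rfl⟩
          exact ⟨_, ⟨l, p, hp, rfl⟩, rfl⟩
        · rintro ⟨_, ⟨l, p, hp, rfl⟩, rfl⟩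
          exact ⟨l, p, hp, rfl⟩)
    (fun f i j hij => grownRows_mono (fun _ _ _ => le_rfl) f hij)
    (fun f i j hij => grownCols_anti (fun _ _ _ => le_rfl) f hij)
    (fun f j => by
      refine le_min ((Finset.card_le_univ _).trans_eq (Fintype.card_fin n)) ?_
      simp only [S, grownRows, Finset.empty_union]
      exact (hcardS _ fun l => (f l).1).trans (hr j j.2))
    (fun f j => by
      refine le_min ((Finset.card_le_univ _).trans_eq (Fintype.card_fin n)) ?_
      simp only [S, grownCols, Finset.empty_union]
      exact (hcardS _ fun l => (f l).2).trans (hc j j.2))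
  have hsum := sum_completable_le (q := q) hm hA N (fun _ => ∅) (fun _ => ∅)
    (fun _ _ _ => le_rfl) (fun _ _ _ => le_rfl) (hN.trans_le (Nat.le_add_left _ _))
  have hΩcard : (Fintype.card Ω : ℝ) = (Fintype.card (Round n (q * 2 ^ m)) : ℝ) ^ N := by
    simp only [hΩ, Fintype.card_fun, Fintype.card_fin, Nat.cast_pow]
  have hΩpos : (0 : ℝ) < (Fintype.card Ω : ℝ) := by
    have : NeZero n := ⟨by omega⟩
    exact_mod_cast Fintype.card_pos
  rw [← hΩcard] at hsum
  have hS : (∑ f : Ω, if BlocksCompletable A d (S f) then (1 : ℝ) else 0) ≤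
      N * (2 * Real.exp (-(q / 16))) * Fintype.card Ω := by
    refine le_trans (Finset.sum_le_sum fun f _ => ite_one_zero_le ?_) hsum
    exact fun ⟨M, hM, h⟩ => ⟨M, hM, fun i hi => h ⟨i, hi⟩⟩
  rw [← hNB] at hle
  refine le_of_mul_le_mul_left ?_ hΩpos
  calc _ ≤ (Fintype.card Ω : ℝ) *
        ∑ ω ∈ nestedBlocks n d c η, if BlocksCompletable A d ω then (1 : ℝ) else 0 := by
        exact mul_le_mul_of_nonneg_left (Finset.sum_le_sum fun ω _ =>
          ite_one_zero_le blocksCompletable_of_minCompletionRank_le) hΩpos.le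
    _ ≤ _ := hle
    _ ≤ (nestedBlocks n d c η).card * (N * (2 * Real.exp (-(q / 16))) * Fintype.card Ω) :=
        mul_le_mul_of_nonneg_left hS hpos.le
    _ = _ := by ring

end FailureProbability

/-! ### Elementary estimates for the parameters. -/

section Parameters

/-- A constant below 1 is what matters: applied to L = log (1/η), it gives log (1/ε) = L - log L ≥ L
/ 3. -/
theorem logb_two_le {x : ℝ} (hx : 0 < x) : Real.logb 2 x ≤ 2 / 3 * x := by
  have h1 := Real.log_le_sub_one_of_pos (div_pos hx (Real.exp_pos 1))
  rw [Real.log_div hx.ne' (Real.exp_pos 1).ne', Real.log_exp] at h1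
  have h2 : x / Real.exp 1 ≤ 2 / 5 * x := by
    rw [div_le_iff₀ (Real.exp_pos 1)]
    nlinarith [Real.exp_one_gt_d9]
  have h3 := Real.log_two_gt_d9
  rw [Real.logb, div_le_iff₀ (by linarith)]
  nlinarith

variable {ε η : ℝ}

/-- Since L = log (1/η) exceeds 1, η ≤ ε ≤ 1/e, so L ≥ log₂ e > 7/5. -/
theorem seven_fifths_le_logb (hε : ε ≤ 1 / Real.exp 1) (hη : 0 < η) (hη2 : η < 1 / 2)
    (h : η * Real.logb 2 (1 / η) = ε) : 7 / 5 ≤ Real.logb 2 (1 / η) := by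
  have hL1 : 1 < Real.logb 2 (1 / η) := by
    rw [Real.lt_logb_iff_rpow_lt (by norm_num) (by positivity), Real.rpow_one,
      lt_div_iff₀ hη]
    linarith
  have hηe : η ≤ 1 / Real.exp 1 := by nlinarith
  have hlog : 1 ≤ Real.log (1 / η) := by
    rw [Real.le_log_iff_exp_le (by positivity), le_div_iff₀ hη]
    rw [le_div_iff₀ (Real.exp_pos 1)] at hηe
    linarith
  have h2 := Real.log_two_lt_d9
  have h3 := Real.log_two_gt_d9
  rw [Real.logb, le_div_iff₀ (by linarith)]
  linarith

theorem one_div_le_two_pow_numBlocks (hη : 0 < η) : 1 / η ≤ 2 ^ numBlocks η := by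
  rw [← Real.rpow_natCast, ← Real.logb_le_iff_le_rpow (by norm_num) (by positivity)]
  exact Nat.le_ceil _

theorem two_pow_numBlocks_mul_le (hη : 0 < η) (hL : 0 ≤ Real.logb 2 (1 / η)) :
    2 ^ numBlocks η * η ≤ 2 := by
  have h1 : (2 : ℝ) ^ numBlocks η ≤ 2 ^ (Real.logb 2 (1 / η) + 1) := by
    rw [← Real.rpow_natCast]
    exact Real.rpow_le_rpow_of_exponent_le (by norm_num) (Nat.ceil_lt_add_one hL).le
  rw [Real.rpow_add_one (by norm_num), Real.rpow_logb (by norm_num) (by norm_num)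
    (by positivity)] at h1
  calc _ ≤ 1 / η * 2 * η := mul_le_mul_of_nonneg_right h1 hη.le
    _ = 2 := by field_simp

theorem logb_one_div_eq (hη : 0 < η) (hL : 0 < Real.logb 2 (1 / η))
    (h : η * Real.logb 2 (1 / η) = ε) :
    Real.logb 2 (1 / ε) = Real.logb 2 (1 / η) - Real.logb 2 (Real.logb 2 (1 / η)) := by
  rw [← Real.logb_div (by positivity) hL.ne', ← h, div_div]

theorem sizeFactor_eq {d : ℕ} (c : ℝ) (hd : 1 ≤ d) (hL : 0 < Real.logb 2 (1 / η)) :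
    sizeFactor d c η = c * Real.logb 2 (d * Real.logb 2 (1 / η)) * (d * Real.logb 2 (1 / η)) := by
  have : (d : ℝ) ≠ 0 := by positivity
  rw [sizeFactor, Real.logb_mul this hL.ne']
  ring

theorem two_fifths_le_logb {x : ℝ} (hx : 7 / 5 ≤ x) : 2 / 5 ≤ Real.logb 2 x := by
  have h1 : Real.logb 2 (2 ^ 2) ≤ Real.logb 2 (x ^ 5) := by
    refine Real.logb_le_logb_of_le (by norm_num) (by norm_num) ?_
    calc (2 : ℝ) ^ 2 ≤ (7 / 5) ^ 5 := by norm_num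
      _ ≤ x ^ 5 := by gcongr
  rw [Real.logb_pow, Real.logb_pow, Real.logb_self_eq_one (by norm_num)] at h1
  push_cast at h1
  linarith

theorem ceil_le_two_mul {x : ℝ} (hx : 1 ≤ x) : (⌈x⌉₊ : ℝ) ≤ 2 * x := by
  linarith [Nat.ceil_lt_add_one (by linarith : 0 ≤ x)]

end Parameters

/-! ### Query complexity, failure bound and choice of parameters. -/

/-- The factors 2 ^ i cancel in the area of each block. The lower bound 2 on the size factor, with 2
^ m η ≤ 2, keeps every size before rounding at least 1, so rounding up at most doubles it. -/
theorem card_querySet_le {n d : ℕ} {c η : ℝ} (hη : 0 < η) (hL : 1 ≤ Real.logb 2 (1 / η))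
    (hs : 2 ≤ sizeFactor d c η) {ω : Blocks n (numBlocks η)} (hω : ω ∈ nestedBlocks n d c η) :
    ((querySet ω).card : ℝ) ≤
      2 * Real.logb 2 (1 / η) * (4 * sizeFactor d c η ^ 2 / η) := by
  classical
  set s := sizeFactor d c η with hsdef
  simp only [nestedBlocks, Finset.mem_filter, Finset.mem_univ, true_and] at hω
  obtain ⟨-, -, hr, hc⟩ := hω
  have hm : (numBlocks η : ℝ) ≤ 2 * Real.logb 2 (1 / η) := ceil_le_two_mul hL
  have hblock : ∀ j : Fin (numBlocks η),
      ((ω.1 j ×ˢ ω.2 j).card : ℝ) ≤ 4 * s ^ 2 / η := by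
    intro j
    have hpow : (1 : ℝ) ≤ 2 ^ ((j : ℕ) + 1) := one_le_pow₀ (by norm_num)
    have h1 : ((ω.1 j).card : ℝ) ≤ 2 * (s * 2 ^ ((j : ℕ) + 1)) := by
      rw [hr j]
      refine le_trans (Nat.cast_le.2 (min_le_right _ _)) (ceil_le_two_mul ?_)
      rw [← hsdef]
      nlinarith
    have h2 : ((ω.2 j).card : ℝ) ≤ 2 * (s / (2 ^ ((j : ℕ) + 1) * η)) := by
      rw [hc j]
      refine le_trans (Nat.cast_le.2 (min_le_right _ _)) (ceil_le_two_mul ?_)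
      rw [← hsdef, le_div_iff₀ (by positivity), one_mul]
      have : (2 : ℝ) ^ ((j : ℕ) + 1) ≤ 2 ^ numBlocks η :=
        pow_le_pow_right₀ (by norm_num) j.2
      exact ((mul_le_mul_of_nonneg_right this hη.le).trans
        (two_pow_numBlocks_mul_le hη (by linarith))).trans hs
    rw [Finset.card_product, Nat.cast_mul]
    refine (mul_le_mul h1 h2 (by positivity) (by positivity)).trans (le_of_eq ?_)
    field_simp
    ring
  calc ((querySet ω).card : ℝ) ≤ ∑ j, ((ω.1 j ×ˢ ω.2 j).card : ℝ) := by
        exact_mod_cast Finset.card_biUnion_le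
    _ ≤ ∑ _j : Fin (numBlocks η), 4 * s ^ 2 / η := Finset.sum_le_sum fun j _ => hblock j
    _ = numBlocks η * (4 * s ^ 2 / η) := by simp
    _ ≤ _ := by gcongr

theorem far_bound_lt {m : ℕ} {n : ℕ} {ε η L D : ℝ} (hn : 1 ≤ n) (hη : 0 < η) (hL : 1 ≤ L)
    (h : η * L = ε) (hm : (m : ℝ) ≤ L + 1) (h2m : 1 / η ≤ 2 ^ m) (hm1 : 1 ≤ m)
    (hD : ε * (n : ℝ) ^ 2 ≤ D) :
    (5 / 16 + ((m : ℝ) - 1) / 64) * ((n : ℝ) ^ 2 / 2 ^ m) < D := by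
  refine lt_of_lt_of_le ?_ hD
  have hn2 : (0 : ℝ) < (n : ℝ) ^ 2 := by positivity
  have hm1' : (1 : ℝ) ≤ m := by exact_mod_cast hm1
  have h2 : (n : ℝ) ^ 2 / 2 ^ m ≤ η * (n : ℝ) ^ 2 := by
    rw [div_le_iff₀ (by positivity)]
    rw [div_le_iff₀ hη] at h2m
    nlinarith
  calc _ ≤ (5 / 16 + ((m : ℝ) - 1) / 64) * (η * (n : ℝ) ^ 2) := by
        refine mul_le_mul_of_nonneg_left h2 (by linarith)
    _ < L * (η * (n : ℝ) ^ 2) := by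
        refine mul_lt_mul_of_pos_right (by linarith) (by positivity)
    _ = ε * (n : ℝ) ^ 2 := by rw [← h]; ring

/-- P stands for d log (1/η). The bound on c makes exp(-q/16) at most 4/3 P ^ (-(k+8)), where 4/3
absorbs the rounding of q. One factor P pays for N, and the other seven pay for the constant 8, as
(7/5)^7 ≥ 8. -/
theorem failure_bound_le {k N q : ℕ} {c P x : ℝ} (hc : 96 * (k + 8) ≤ c) (hP : 7 / 5 ≤ P)
    (hN : (N : ℝ) ≤ 3 * P) (hq : c * Real.logb 2 P / 6 ≤ q + 1) (hx : 0 < x) (hxP : x ≤ P) :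
    N * (2 * Real.exp (-(q / 16))) ≤ 1 / x ^ k := by
  have hP0 : 0 < P := by linarith
  have hlogP : 0 ≤ Real.log P := Real.log_nonneg (by linarith)
  have hlogb : Real.log P ≤ Real.logb 2 P := by
    rw [Real.logb, le_div_iff₀ (by linarith [Real.log_two_gt_d9])]
    nlinarith [Real.log_two_lt_d9]
  have hexp : Real.exp (1 / 16) ≤ 4 / 3 := by
    have h1 := Real.add_one_le_exp (-(1 / 16) : ℝ)
    rw [Real.exp_neg] at h1
    have h2 := Real.exp_pos (1 / 16)
    have h3 := mul_inv_cancel₀ h2.ne'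
    nlinarith
  have hk : (0 : ℝ) ≤ k := by positivity
  have h1 : -((q : ℝ) / 16) ≤ 1 / 16 + ((k + 8 : ℕ) : ℝ) * (-Real.log P) := by
    have : 96 * ((k : ℝ) + 8) * Real.log P ≤ c * Real.logb 2 P :=
      mul_le_mul hc hlogb hlogP (by linarith)
    push_cast
    nlinarith
  have h2 : Real.exp (-(q / 16)) ≤ 4 / 3 * (1 / P ^ (k + 8)) := by
    refine (Real.exp_le_exp.2 h1).trans ?_
    rw [Real.exp_add, Real.exp_nat_mul, Real.exp_neg, Real.exp_log hP0, inv_pow, ← one_div (P ^ _)]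
    exact mul_le_mul_of_nonneg_right hexp (by positivity)
  have h7 : 8 ≤ P ^ 7 := le_trans (by norm_num) (pow_le_pow_left₀ (by norm_num) hP 7)
  calc N * (2 * Real.exp (-(q / 16))) ≤ 3 * P * (2 * (4 / 3 * (1 / P ^ (k + 8)))) := by gcongr
    _ = 8 / P ^ 7 * (1 / P ^ k) := by
        rw [show k + 8 = k + 7 + 1 by ring, pow_succ, pow_add]
        field_simp
        norm_num
    _ ≤ 1 * (1 / P ^ k) := by
        refine mul_le_mul_of_nonneg_right ?_ (by positivity)
        rw [div_le_one (by positivity)]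
        exact h7
    _ ≤ 1 / x ^ k := by
        rw [one_mul]
        exact one_div_le_one_div_of_le (by positivity) (pow_le_pow_left₀ hx.le hxP k)

theorem card_querySet_le_polylog {n d : ℕ} {c ε η : ℝ} (hc : 96 ≤ c) (hd : 1 ≤ d) (hη : 0 < η)
    (h : η * Real.logb 2 (1 / η) = ε) (hL : 7 / 5 ≤ Real.logb 2 (1 / η))
    {ω : Blocks n (numBlocks η)} (hω : ω ∈ nestedBlocks n d c η) :
    ((querySet ω).card : ℝ) ≤
      8 * 81 * 16 * c ^ 2 * ((d : ℝ) ^ 2 / ε) * Real.logb 2 (d / ε) ^ 6 := by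
  have hd' : (1 : ℝ) ≤ d := by exact_mod_cast hd
  have hℓ := logb_one_div_eq hη (by linarith) h
  have hs := sizeFactor_eq c hd (by linarith : 0 < Real.logb 2 (1 / η))
  have hlogL := logb_two_le (by linarith : 0 < Real.logb 2 (1 / η))
  have hε : 0 < ε := h ▸ mul_pos hη (by linarith)
  have hΛ : Real.logb 2 (d / ε) = Real.logb 2 d + Real.logb 2 (1 / ε) := by
    rw [← Real.logb_mul (by positivity) (by positivity), mul_one_div]
  have hlogd : 0 ≤ Real.logb 2 d := Real.logb_nonneg (by norm_num) hd'
  have hcard := fun hs2 => card_querySet_le hη (by linarith) hs2 hω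
  have hlam : Real.logb 2 (d * Real.logb 2 (1 / η)) =
      Real.logb 2 d + Real.logb 2 (Real.logb 2 (1 / η)) :=
    Real.logb_mul (by positivity) (by linarith)
  set L := Real.logb 2 (1 / η) with hLdef
  have hP : 7 / 5 ≤ d * L := by nlinarith
  have hlam1 := two_fifths_le_logb hP
  set lam := Real.logb 2 (d * L) with hlamdef
  set Lam := Real.logb 2 (d / ε) with hLamdef
  have hLLam : L ≤ 3 * Lam := by linarith
  have hlamLam : lam ≤ 4 * Lam := by linarith
  have hs2 : 2 ≤ sizeFactor d c η := by
    rw [hs]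
    have : 96 * (2 / 5) ≤ c * lam := mul_le_mul hc hlam1 (by norm_num) (by linarith)
    nlinarith
  refine (hcard hs2).trans ?_
  have hηε : η = ε / L := by rw [← h]; field_simp
  rw [hs]
  -- Of the four factors L, one counts the blocks, two come from the squared size factor, and one
  -- from 1/η = L/ε.
  calc 2 * L * (4 * (c * lam * (d * L)) ^ 2 / η) = 8 * c ^ 2 * ((d : ℝ) ^ 2 / ε) *
        (L ^ 4 * lam ^ 2) := by
        rw [hηε]
        field_simp
        ring
    _ ≤ 8 * c ^ 2 * ((d : ℝ) ^ 2 / ε) * ((3 * Lam) ^ 4 * (4 * Lam) ^ 2) := by gcongr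
    _ = _ := by ring

theorem rankTester_le_of_isFarFromRank {F : Type*} [Field F] {n d k : ℕ} {c ε η : ℝ} (hn : 1 ≤ n)
    (hd : 1 ≤ d) (hc : 96 * (k + 8) ≤ c) (hη : 0 < η) (h : η * Real.logb 2 (1 / η) = ε)
    (hL : 7 / 5 ≤ Real.logb 2 (1 / η)) {A : Matrix (Fin n) (Fin n) F}
    (hA : IsFarFromRank A d ε) :
    rankTester d c η A Verdict.rankAtMost ≤
      ENNReal.ofReal (1 / (d * Real.logb 2 (1 / ε)) ^ k) := by
  have hd' : (1 : ℝ) ≤ d := by exact_mod_cast hd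
  have hk : (0 : ℝ) ≤ k := by positivity
  have hℓ := logb_one_div_eq hη (by linarith) h
  have hs := sizeFactor_eq c hd (by linarith : 0 < Real.logb 2 (1 / η))
  have hlogL := logb_two_le (by linarith : 0 < Real.logb 2 (1 / η))
  have hlogL0 : 0 ≤ Real.logb 2 (Real.logb 2 (1 / η)) :=
    Real.logb_nonneg (by norm_num) (by linarith)
  have hmL : (numBlocks η : ℝ) ≤ Real.logb 2 (1 / η) + 1 := (Nat.ceil_lt_add_one (by linarith)).le
  have hm1 : 1 ≤ numBlocks η := Nat.one_le_ceil_iff.2 (by linarith)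
  have h2m := one_div_le_two_pow_numBlocks hη
  have h2m' := two_pow_numBlocks_mul_le hη (by linarith)
  set L := Real.logb 2 (1 / η) with hLdef
  set m := numBlocks η with hmdef
  have hP : 7 / 5 ≤ d * L := by nlinarith
  have hlam1 := two_fifths_le_logb hP
  set lam := Real.logb 2 (d * L) with hlamdef
  have hclam : 0 ≤ c * lam / 6 := by
    have : 0 ≤ c := by linarith
    positivity
  -- The 6 splits as 3 · 2: N = d m + 1 is at most 3 d L, and 2 ^ m η ≤ 2 costs a factor 2 in the
  -- column sizes.
  set q := ⌊c * lam / 6⌋₊ with hqdef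
  have hq := Nat.floor_le hclam
  rw [← hqdef] at hq
  have hN : ((d * m + 1 : ℕ) : ℝ) ≤ 3 * (d * L) := by
    push_cast
    nlinarith
  have hNq : ((d * m + 1 : ℕ) : ℝ) * q * 2 ≤ sizeFactor d c η := by
    rw [hs]
    calc ((d * m + 1 : ℕ) : ℝ) * q * 2 ≤ 3 * (d * L) * (c * lam / 6) * 2 := by gcongr
      _ = _ := by ring
  have hNq0 : (0 : ℝ) ≤ ((d * m + 1 : ℕ) : ℝ) * q := by positivity
  refine (rankTester_le (q := q) (N := d * m + 1) hn hm1 (fun B hB =>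
    far_bound_lt hn hη (by linarith) h hmL h2m hm1 (hA B hB)) (Nat.lt_succ_self _) ?_ ?_).trans
    (ENNReal.ofReal_le_ofReal (failure_bound_le hc hP hN (Nat.lt_floor_add_one _).le ?_ ?_))
  · intro j _
    rw [← Nat.cast_le (α := ℝ)]
    refine le_trans ?_ (Nat.le_ceil _)
    rw [← mul_assoc, Nat.cast_mul, Nat.cast_mul, Nat.cast_pow, Nat.cast_ofNat]
    exact mul_le_mul_of_nonneg_right (by linarith) (by positivity)
  · intro j hj
    rw [← Nat.cast_le (α := ℝ)]
    refine le_trans ?_ (Nat.le_ceil _)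
    rw [← mul_assoc, Nat.cast_mul, Nat.cast_mul, Nat.cast_pow, Nat.cast_ofNat,
      le_div_iff₀ (by positivity)]
    have hpow : (2 : ℝ) ^ (m - 1 - j) * 2 ^ (j + 1) = 2 ^ m := by
      rw [← pow_add]
      congr 1
      omega
    calc ((d * m + 1 : ℕ) : ℝ) * q * 2 ^ (m - 1 - j) * (2 ^ (j + 1) * η)
        = ((d * m + 1 : ℕ) : ℝ) * q * ((2 ^ (m - 1 - j) * 2 ^ (j + 1)) * η) := by ring
      _ ≤ ((d * m + 1 : ℕ) : ℝ) * q * 2 := by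
          rw [hpow]
          exact mul_le_mul_of_nonneg_left h2m' hNq0
      _ ≤ _ := hNq
  · have : 0 < Real.logb 2 (1 / ε) := by linarith
    positivity
  · exact mul_le_mul_of_nonneg_left (by linarith) (by linarith)

end RankTesting

theorem mainTheorem1 :
    ∃ K : ℕ, ∀ k : ℕ, ∃ c₀ : ℝ, 0 < c₀ ∧ ∀ c : ℝ, c₀ ≤ c → ∃ C : ℝ, 0 < C ∧
      ∀ (n d : ℕ) (ε η : ℝ), 1 ≤ n → 1 ≤ d → 0 < ε → ε ≤ 1 / Real.exp 1 →
        0 < η → η < 1 / 2 → η * Real.logb 2 (1 / η) = ε →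
        (∀ ω ∈ (RankTesting.blockLaw n d c η).support,
          ((RankTesting.querySet ω).card : ℝ) ≤
            C * ((d : ℝ) ^ 2 / ε) * Real.logb 2 (d / ε) ^ K) ∧
        ∀ (F : Type*) [Field F] (A : Matrix (Fin n) (Fin n) F),
          (A.rank ≤ d →
            RankTesting.rankTester d c η A RankTesting.Verdict.rankAtMost = 1) ∧
          (RankTesting.IsFarFromRank A d ε →
            RankTesting.rankTester d c η A RankTesting.Verdict.rankAtMost ≤
              ENNReal.ofReal (1 / (d * Real.logb 2 (1 / ε)) ^ k)) := by
  -- The exponent is 4 + 2, from L ^ 4 and the squared factor log (d L) in the query count.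
  refine ⟨6, fun k => ⟨96 * (k + 8), by positivity, fun c hc => ?_⟩⟩
  have hk : (0 : ℝ) ≤ k := by positivity
  have hc96 : 96 ≤ c := by linarith
  have hc0 : 0 < c := by linarith
  refine ⟨8 * 81 * 16 * c ^ 2, by positivity, ?_⟩
  intro n d ε η hn hd _ hε hη hη2 h
  have hL := RankTesting.seven_fifths_le_logb hε hη hη2 h
  refine ⟨fun ω hω => ?_, fun F _ A => ⟨RankTesting.rankTester_eq_one,
    RankTesting.rankTester_le_of_isFarFromRank hn hd hc hη h hL⟩⟩
  rw [RankTesting.blockLaw, PMF.support_uniformOfFinset, Finset.mem_coe] at hω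
  exact RankTesting.card_querySet_le_polylog hc96 hd hη h hL hω
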